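/- Let $\beta\in(1,2)$ satisfy $\beta^m=\beta^{m-1}+\cdots+\beta+1$ for some integer $m\ge 2$ (such a $\beta$ is called a pseudo-golden ratio), and let $$c=\frac{(m-1)(2-\beta)}{2(m\beta+\beta-2m)}.$$ Then $c>0$, and for every $p\in[\frac12-c,\frac12+c]$, Lebesgue almost every $x\in I_\beta:=[0,\frac{1}{\beta-1}]$ has infinitely many $\beta$-expansions in which the frequency of zeros equals $p$. Here a $\beta$-expansion of $x$ is a sequence $(\epsilon_i)_{i\ge1}\in\{0,1\}^{\mathbb N}$ with $x=\sum_{i=1}^\infty \epsilon_i\beta^{-i}$, and its frequency of zeros equals $p$ if $\lim_{n\to\infty}\frac1n\#\{1\le i\le n:\epsilon_i=0\}$ exists and equals $p$. -/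

import Mathlib

open Filter Topology MeasureTheory

/-- The digit alphabet in base `β > 1`: `{0, …, β - 1}` if `β` is an integer and
`{0, …, ⌊β⌋}` otherwise, that is, in both cases the natural numbers below `⌈β⌉`. -/
def betaAlphabet (β : ℝ) : Set ℕ := {k | k < ⌈β⌉₊}

/-- The interval `I_β`: `[0, 1]` if `β > 1` is an integer and `[0, ⌊β⌋ / (β - 1)]` otherwise,
that is, in both cases `[0, (⌈β⌉ - 1) / (β - 1)]`. -/
def betaInterval (β : ℝ) : Set ℝ := Set.Icc 0 (((⌈β⌉₊ : ℝ) - 1) / (β - 1))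

/-- `ε` is a `β`-expansion of `x`. The term `ε i` is the digit number `i + 1`, so that
`x = ∑_{i ≥ 0} ε i / β ^ (i + 1)`. -/
def IsBetaExpansion (β x : ℝ) (ε : ℕ → ℕ) : Prop :=
  (∀ i, ε i ∈ betaAlphabet β) ∧ HasSum (fun i : ℕ => (ε i : ℝ) / β ^ (i + 1)) x

/-- The frequency of the digit `k` in `ε` exists and equals `p`: the proportion of the digit `k`
among the first `n` digits converges to `p`. -/
def HasDigitFreq (ε : ℕ → ℕ) (k : ℕ) (p : ℝ) : Prop :=
  Tendsto (fun n : ℕ => (((Finset.range n).filter (fun i => ε i = k)).card : ℝ) / (n : ℝ))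
    atTop (𝓝 p)

/-! Write q = β⁻¹. The relation q + ... + q^m = 1 is used twice.

It makes the greedy digits of a point of [0, 1) a sequence of independent blocks 1^j 0 with j < m:
reading one block is the map `blockMap`, affine with slope β^(j+1) from [`cut β j`, `cut β (j+1)`)
onto [0, 1). So `blockMap` preserves Lebesgue measure, and the block 1^j 0 has probability q^(j+1).
By a law of large numbers (`ae_tendsto_weighted_average`) the greedy expansion almost surely has
frequency of zeros 1/l, where l is the mean block length, and 1/l = 1/2 + c.

It also allows the word 1 0^m to be replaced by 0 1^m without changing the value (`hasSum_carry`);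
each such carry removes m - 1 zeros (`hasDigitFreq_carry`). Select a deterministic set of blocks of
density t. In a selected block, carry at its last 1 if m zeros follow, and carry once more, at the
last 1 just created, if 2m zeros follow. The frequency of zeros becomes (1 - (m-1) t (d₁ + d₂)) / l,
where d₁ and d₂ are the probabilities of the two events. By `reduction_bound` this is at most 1/2
for t = 1, so every p in [1/2, 1/2 + c] is reached by some t.

Changing the selection on finitely many blocks leaves the frequency alone and yields infinitely many
expansions (`infinite_expansions`). Points x ≥ 1 are reached by prefixing ones, and p < 1/2 by
exchanging the two digits. -/

/-! ### Law of large numbers and limits of averages. -/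

/-- The matrix of the integrals of `Y j * Y k` vanishes off the band |j - k| < N, so each row has at
most 2N nonzero entries, each at most M². -/
theorem integral_sq_sum_le_of_orthogonal {Ω : Type*} [MeasurableSpace Ω] {μ : Measure Ω}
    [IsProbabilityMeasure μ] {Y : ℕ → Ω → ℝ} (hY : ∀ k, Measurable (Y k)) {M : ℝ}
    (hM : ∀ k ω, |Y k ω| ≤ M) {N : ℕ}
    (horth : ∀ j k, j + N ≤ k → ∫ ω, Y j ω * Y k ω ∂μ = 0) (n : ℕ) :
    ∫ ω, (∑ k ∈ Finset.range n, Y k ω) ^ 2 ∂μ ≤ 2 * N * M ^ 2 * n := by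
  have hbd : ∀ j k ω, ‖Y j ω * Y k ω‖ ≤ M ^ 2 := by
    intro j k ω
    rw [Real.norm_eq_abs, abs_mul, sq]
    exact mul_le_mul (hM j ω) (hM k ω) (abs_nonneg _) ((abs_nonneg _).trans (hM j ω))
  have hint : ∀ j k, Integrable (fun ω => Y j ω * Y k ω) μ := fun j k =>
    Integrable.of_bound ((hY j).mul (hY k)).aestronglyMeasurable (M ^ 2)
      (Eventually.of_forall (hbd j k))
  have hle : ∀ j k, ∫ ω, Y j ω * Y k ω ∂μ ≤ M ^ 2 := by
    intro j k
    have := norm_integral_le_of_norm_le_const (μ := μ) (Eventually.of_forall (hbd j k))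
    simp only [probReal_univ, mul_one] at this
    exact (le_abs_self _).trans this
  have hexp : ∫ ω, (∑ k ∈ Finset.range n, Y k ω) ^ 2 ∂μ
      = ∑ j ∈ Finset.range n, ∑ k ∈ Finset.range n, ∫ ω, Y j ω * Y k ω ∂μ := by
    simp_rw [sq, Finset.sum_mul_sum]
    rw [integral_finsetSum _ fun j _ => integrable_finsetSum _ fun k _ => hint j k]
    exact Finset.sum_congr rfl fun j _ => integral_finsetSum _ fun k _ => hint j k
  have hrow : ∀ j, ∑ k ∈ Finset.range n, ∫ ω, Y j ω * Y k ω ∂μ ≤ 2 * N * M ^ 2 := by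
    intro j
    calc ∑ k ∈ Finset.range n, ∫ ω, Y j ω * Y k ω ∂μ
        ≤ ∑ k ∈ Finset.range n, if k ∈ Finset.Ico (j + 1 - N) (j + N) then M ^ 2 else 0 := by
          refine Finset.sum_le_sum fun k _ => ?_
          split_ifs with h
          · exact hle j k
          · rw [Finset.mem_Ico, not_and_or] at h
            rcases h with h | h
            · have := horth k j (by omega)
              simp_rw [mul_comm (Y k _)] at this
              exact this.le
            · exact (horth j k (by omega)).le
      _ ≤ ∑ k ∈ Finset.Ico (j + 1 - N) (j + N), M ^ 2 := by
          rw [← Finset.sum_filter]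
          refine Finset.sum_le_sum_of_subset_of_nonneg ?_ fun _ _ _ => sq_nonneg M
          intro k hk
          exact (Finset.mem_filter.1 hk).2
      _ ≤ 2 * N * M ^ 2 := by
          rw [Finset.sum_const, nsmul_eq_mul, Nat.card_Ico]
          refine mul_le_mul_of_nonneg_right ?_ (sq_nonneg M)
          have : j + N - (j + 1 - N) ≤ 2 * N := by omega
          exact_mod_cast this
  rw [hexp]
  calc _ ≤ ∑ _j ∈ Finset.range n, 2 * (N : ℝ) * M ^ 2 := Finset.sum_le_sum fun j _ => hrow j
    _ = _ := by rw [Finset.sum_const, Finset.card_range, nsmul_eq_mul]; ring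

/-- Between r² and n ≤ r² + 2r there are at most 2r terms; they contribute at most 2Mr, which is
negligible against r². -/
theorem tendsto_average_of_tendsto_average_sq {u : ℕ → ℝ} {M : ℝ} (hM : ∀ k, |u k| ≤ M)
    (h : Tendsto (fun n : ℕ => (∑ k ∈ Finset.range (n ^ 2), u k) / (n : ℝ) ^ 2) atTop (𝓝 0)) :
    Tendsto (fun n : ℕ => (∑ k ∈ Finset.range n, u k) / (n : ℝ)) atTop (𝓝 0) := by
  have hsq : Tendsto Nat.sqrt atTop atTop :=
    tendsto_atTop.2 fun b => (eventually_ge_atTop (b ^ 2)).mono fun n hn => Nat.le_sqrt'.2 hn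
  have h1 : Tendsto (fun n : ℕ => |(∑ k ∈ Finset.range (n ^ 2), u k) / (n : ℝ) ^ 2|
      + 2 * M / n) atTop (𝓝 0) := by
    simpa using h.abs.add (tendsto_const_div_atTop_nhds_zero_nat (2 * M))
  refine squeeze_zero_norm' ?_ (h1.comp hsq)
  filter_upwards [eventually_ge_atTop 1] with n hn
  simp only [Function.comp, Real.norm_eq_abs]
  set r := Nat.sqrt n with hr
  have hr1 : 1 ≤ r := Nat.le_sqrt'.2 (by simpa using hn)
  have hrn : r ^ 2 ≤ n := Nat.sqrt_le' n
  have hnr : n ≤ r ^ 2 + 2 * r := by have := Nat.sqrt_le_add n; rw [← hr] at this; nlinarith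
  have hr0 : (0 : ℝ) < r := by exact_mod_cast hr1
  have hn0 : (0 : ℝ) < n := by exact_mod_cast hn
  have hM0 : 0 ≤ M := (abs_nonneg _).trans (hM 0)
  have hdiff : |∑ k ∈ Finset.range n, u k|
      ≤ |∑ k ∈ Finset.range (r ^ 2), u k| + 2 * M * r := by
    rw [← Finset.sum_range_add_sum_Ico _ hrn]
    refine (abs_add_le _ _).trans (add_le_add_right ?_ _)
    refine (Finset.abs_sum_le_sum_abs _ _).trans ((Finset.sum_le_sum fun k _ => hM k).trans ?_)
    rw [Finset.sum_const, nsmul_eq_mul, Nat.card_Ico]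
    have : ((n - r ^ 2 : ℕ) : ℝ) ≤ 2 * r := by
      have : n - r ^ 2 ≤ 2 * r := by omega
      exact_mod_cast this
    nlinarith
  rw [abs_div, abs_div, abs_of_pos hn0, abs_of_pos (pow_pos hr0 2)]
  have hrn' : (r : ℝ) ^ 2 ≤ n := by exact_mod_cast hrn
  calc _ ≤ (|∑ k ∈ Finset.range (r ^ 2), u k| + 2 * M * r) / n := by gcongr
    _ ≤ (|∑ k ∈ Finset.range (r ^ 2), u k| + 2 * M * r) / (r : ℝ) ^ 2 := by gcongr
    _ = _ := by field_simp

/-- A strong law of large numbers for bounded variables that are orthogonal as soon as their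
indices are far apart. -/
theorem ae_tendsto_average_of_orthogonal {Ω : Type*} [MeasurableSpace Ω] {μ : Measure Ω}
    [IsProbabilityMeasure μ] {Y : ℕ → Ω → ℝ} (hY : ∀ k, Measurable (Y k)) {M : ℝ}
    (hM : ∀ k ω, |Y k ω| ≤ M) {N : ℕ}
    (horth : ∀ j k, j + N ≤ k → ∫ ω, Y j ω * Y k ω ∂μ = 0) :
    ∀ᵐ ω ∂μ, Tendsto (fun n : ℕ => (∑ k ∈ Finset.range n, Y k ω) / (n : ℝ)) atTop (𝓝 0) := by
  -- Along the squares the mean of the squared average is O(1/n²), which is summable; hence the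
  -- squared averages are almost surely summable and tend to 0. The shift to n + 1 avoids dividing
  -- by 0.
  set A : ℕ → Ω → ℝ := fun n ω =>
    ((∑ k ∈ Finset.range ((n + 1) ^ 2), Y k ω) / ((n + 1 : ℕ) : ℝ) ^ 2) ^ 2 with hA
  have hAm : ∀ n, Measurable (A n) := fun n =>
    ((Finset.measurable_sum _ fun k _ => hY k).div_const _).pow_const 2
  have hM0 : 0 ≤ M := by
    obtain ⟨ω⟩ := μ.nonempty_of_neZero
    exact (abs_nonneg _).trans (hM 0 ω)
  have hAi : ∀ n, Integrable (A n) μ := by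
    intro n
    refine Integrable.of_bound (hAm n).aestronglyMeasurable (M ^ 2) (Eventually.of_forall ?_)
    intro ω
    have hpos : (0 : ℝ) < ((n + 1 : ℕ) : ℝ) ^ 2 := by positivity
    have : |(∑ k ∈ Finset.range ((n + 1) ^ 2), Y k ω) / ((n + 1 : ℕ) : ℝ) ^ 2| ≤ M := by
      rw [abs_div, abs_of_pos hpos, div_le_iff₀ hpos]
      refine (Finset.abs_sum_le_sum_abs _ _).trans
        ((Finset.sum_le_sum fun k _ => hM k ω).trans ?_)
      rw [Finset.sum_const, nsmul_eq_mul, Finset.card_range]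
      push_cast
      exact (mul_comm _ _).le
    rw [hA, Real.norm_eq_abs, abs_pow]
    exact pow_le_pow_left₀ (abs_nonneg _) this 2
  have hAl : ∀ n, ∫⁻ ω, ENNReal.ofReal (A n ω) ∂μ
      ≤ ENNReal.ofReal (2 * N * M ^ 2 * (1 / ((n : ℝ) + 1) ^ 2)) := by
    intro n
    rw [← ofReal_integral_eq_lintegral_ofReal (hAi n)
      (Eventually.of_forall fun ω => sq_nonneg _)]
    refine ENNReal.ofReal_le_ofReal ?_
    simp_rw [hA, div_pow]
    rw [integral_div]
    have := integral_sq_sum_le_of_orthogonal (μ := μ) hY hM horth ((n + 1) ^ 2)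
    rw [div_le_iff₀ (by positivity)]
    refine this.trans (le_of_eq ?_)
    push_cast
    field_simp
  have hsum : ∑' n : ℕ, ENNReal.ofReal (2 * N * M ^ 2 * (1 / ((n : ℝ) + 1) ^ 2)) ≠ ⊤ := by
    have hs : Summable fun n : ℕ => 2 * N * M ^ 2 * (1 / ((n : ℝ) + 1) ^ 2) := by
      refine Summable.mul_left _ ?_
      have := (summable_nat_add_iff 1).2 (Real.summable_one_div_nat_pow.2 (one_lt_two))
      simpa using this
    rw [← ENNReal.ofReal_tsum_of_nonneg (fun n => by positivity) hs]
    exact ENNReal.ofReal_ne_top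
  have hfin : ∫⁻ ω, ∑' n, ENNReal.ofReal (A n ω) ∂μ ≠ ⊤ := by
    rw [lintegral_tsum fun n => (hAm n).ennreal_ofReal.aemeasurable]
    exact ne_top_of_le_ne_top hsum (ENNReal.tsum_le_tsum hAl)
  filter_upwards [ae_lt_top (Measurable.tsum fun n => (hAm n).ennreal_ofReal) hfin]
    with ω hω
  refine tendsto_average_of_tendsto_average_sq (fun k => hM k ω) ?_
  have h0 := ENNReal.tendsto_atTop_zero_of_tsum_ne_top hω.ne
  have h1 : Tendsto (fun n => A n ω) atTop (𝓝 0) := by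
    have := (ENNReal.tendsto_toReal ENNReal.zero_ne_top).comp h0
    refine this.congr fun n => ?_
    exact ENNReal.toReal_ofReal (sq_nonneg _)
  have h2 := h1.sqrt
  rw [Real.sqrt_zero] at h2
  simp_rw [hA, Real.sqrt_sq_eq_abs] at h2
  exact (tendsto_add_atTop_iff_nat 1).1 ((tendsto_zero_iff_abs_tendsto_zero _).2 h2)

/-- Turns averages per block into averages per digit: `n K` will be the start of block K, and
monotonicity squeezes `F N` between its values at the two block starts around N. -/
theorem tendsto_div_of_tendsto_div_strictMono {F : ℕ → ℝ} (hF : Monotone F) (hF0 : 0 ≤ F 0)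
    {n : ℕ → ℕ} (hn : StrictMono n) (hn0 : n 0 = 0) {l e : ℝ} (hl : 0 < l)
    (h1 : Tendsto (fun K : ℕ => (n K : ℝ) / K) atTop (𝓝 l))
    (h2 : Tendsto (fun K : ℕ => F (n K) / K) atTop (𝓝 e)) :
    Tendsto (fun N : ℕ => F N / N) atTop (𝓝 (e / l)) := by
  -- Searching only up to N loses nothing, since K ≤ `n K`.
  set κ : ℕ → ℕ := fun N => Nat.findGreatest (fun K => n K ≤ N) N with hκ
  have hle : ∀ N, n (κ N) ≤ N := fun N =>
    Nat.findGreatest_spec (P := fun K => n K ≤ N) (Nat.zero_le N) (by simp [hn0])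
  have hlt : ∀ N, N < n (κ N + 1) := by
    intro N
    by_contra! hcon
    have := Nat.le_findGreatest (P := fun K => n K ≤ N) ((hn.le_apply).trans hcon) hcon
    simp only [hκ] at this
    omega
  have hκt : Tendsto κ atTop atTop := tendsto_atTop.2 fun K =>
    (eventually_ge_atTop (n K)).mono fun N hN =>
      Nat.le_findGreatest (P := fun K => n K ≤ N) (hn.le_apply.trans hN) hN
  have hs : Tendsto (fun K : ℕ => K + 1) atTop atTop := tendsto_add_atTop_nat 1
  have hr : Tendsto (fun K : ℕ => ((K + 1 : ℕ) : ℝ) / K) atTop (𝓝 1) := by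
    have := (tendsto_const_nhds (x := (1 : ℝ))).add
      (tendsto_const_div_atTop_nhds_zero_nat (𝕜 := ℝ) 1)
    rw [add_zero] at this
    refine this.congr' ?_
    filter_upwards [eventually_ge_atTop 1] with K hK
    have : (K : ℝ) ≠ 0 := by positivity
    push_cast
    field_simp
  have hlow : Tendsto (fun K : ℕ => F (n K) / n (K + 1)) atTop (𝓝 (e / l)) := by
    have := (h2.div (h1.comp hs) hl.ne').div hr one_ne_zero
    rw [div_one] at this
    refine this.congr' ?_
    filter_upwards [eventually_ge_atTop 1] with K hK
    have h0 : (K : ℝ) ≠ 0 := by positivity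
    have h0' : ((K + 1 : ℕ) : ℝ) ≠ 0 := by positivity
    simp only [Pi.div_apply, Function.comp]
    field_simp
  have hup : Tendsto (fun K : ℕ => F (n (K + 1)) / n K) atTop (𝓝 (e / l)) := by
    have := ((h2.comp hs).div h1 hl.ne').mul hr
    rw [mul_one] at this
    refine this.congr' ?_
    filter_upwards [eventually_ge_atTop 1] with K hK
    have h0 : (K : ℝ) ≠ 0 := by positivity
    have h0' : ((K + 1 : ℕ) : ℝ) ≠ 0 := by positivity
    simp only [Pi.div_apply, Function.comp]
    field_simp
  have hF' : ∀ N, 0 ≤ F N := fun N => hF0.trans (hF (Nat.zero_le N))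
  refine tendsto_of_tendsto_of_tendsto_of_le_of_le' (hlow.comp hκt) (hup.comp hκt) ?_ ?_
  · filter_upwards [eventually_ge_atTop 1] with N hN
    simp only [Function.comp]
    have h0 : (0 : ℝ) < N := by positivity
    have h3 : (N : ℝ) ≤ n (κ N + 1) := by exact_mod_cast (hlt N).le
    calc F (n (κ N)) / n (κ N + 1) ≤ F (n (κ N)) / N :=
          div_le_div_of_nonneg_left (hF' _) h0 h3
      _ ≤ F N / N := by gcongr; exact hF (hle N)
  · filter_upwards [hκt.eventually_ge_atTop 1] with N hN
    simp only [Function.comp]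
    have h0 : (0 : ℝ) < n (κ N) := by
      have : 1 ≤ n (κ N) := hN.trans hn.le_apply
      positivity
    have h3 : (n (κ N) : ℝ) ≤ N := by exact_mod_cast hle N
    calc F N / N ≤ F N / n (κ N) := div_le_div_of_nonneg_left (hF' _) h0 h3
      _ ≤ _ := by gcongr; exact hF (hlt N).le

theorem tendsto_average_of_eq_of_lt {u v : ℕ → ℝ} {l : ℝ} {j : ℕ} (huv : ∀ k, j < k → u k = v k)
    (h : Tendsto (fun n : ℕ => (∑ k ∈ Finset.range n, u k) / (n : ℝ)) atTop (𝓝 l)) :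
    Tendsto (fun n : ℕ => (∑ k ∈ Finset.range n, v k) / (n : ℝ)) atTop (𝓝 l) := by
  have h1 := h.add (tendsto_const_div_atTop_nhds_zero_nat
    (∑ k ∈ Finset.range (j + 1), v k - ∑ k ∈ Finset.range (j + 1), u k))
  rw [add_zero] at h1
  refine h1.congr' ?_
  filter_upwards [eventually_ge_atTop (j + 1)] with n hn
  rw [← add_div, ← Finset.sum_range_add_sum_Ico u hn, ← Finset.sum_range_add_sum_Ico v hn,
    Finset.sum_congr rfl fun k hk => huv k (Finset.mem_Ico.1 hk).1]
  ring

theorem tendsto_shift_div {F : ℕ → ℝ} {l : ℝ}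
    (h : Tendsto (fun N : ℕ => F N / N) atTop (𝓝 l)) (i : ℕ) :
    Tendsto (fun N : ℕ => F (N - i) / N) atTop (𝓝 l) := by
  rw [← tendsto_add_atTop_iff_nat i]
  have hr : Tendsto (fun N : ℕ => (N : ℝ) / ((N + i : ℕ) : ℝ)) atTop (𝓝 1) := by
    simpa using tendsto_natCast_div_add_atTop (𝕜 := ℝ) (i : ℝ)
  have := h.mul hr
  rw [mul_one] at this
  refine this.congr' ?_
  filter_upwards [eventually_ge_atTop 1] with N hN
  have h0 : (N : ℝ) ≠ 0 := by positivity
  have h0' : ((N + i : ℕ) : ℝ) ≠ 0 := by positivity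
  rw [Nat.add_sub_cancel]
  field_simp

/-! ### Pseudo-golden bases and the block map. -/

/-- `β ∈ (1, 2)` is the pseudo-golden ratio of order `m`. -/
structure IsPseudoGolden (β : ℝ) (m : ℕ) : Prop where
  one_lt : 1 < β
  lt_two : β < 2
  two_le : 2 ≤ m
  root : β ^ m = ∑ i ∈ Finset.range m, β ^ i

/-- The number whose `β`-expansion is `j` ones followed by zeros. -/
noncomputable def cut (β : ℝ) (j : ℕ) : ℝ := ∑ i ∈ Finset.range j, β⁻¹ ^ (i + 1)

/-- The number of ones in front of the first zero in the greedy expansion of a point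
of `[0, 1)`. -/
noncomputable def blockIndex (β : ℝ) (m : ℕ) (y : ℝ) : ℕ :=
  ∑ j ∈ Finset.range (m - 1), if cut β (j + 1) ≤ y then 1 else 0

/-- The greedy map, iterated until the first zero digit has been read. -/
noncomputable def blockMap (β : ℝ) (m : ℕ) (y : ℝ) : ℝ :=
  β ^ (blockIndex β m y + 1) * (y - cut β (blockIndex β m y))

theorem cut_zero (β : ℝ) : cut β 0 = 0 := by simp [cut]

theorem cut_succ (β : ℝ) (j : ℕ) : cut β (j + 1) = cut β j + β⁻¹ ^ (j + 1) := by
  simp [cut, Finset.sum_range_succ]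

theorem blockIndex_le (β : ℝ) (m : ℕ) (y : ℝ) : blockIndex β m y ≤ m - 1 := by
  unfold blockIndex
  refine (Finset.sum_le_card_nsmul _ _ 1 fun j _ => ?_).trans (by simp)
  split_ifs <;> simp

theorem measurable_blockIndex (β : ℝ) (m : ℕ) : Measurable (blockIndex β m) :=
  Finset.measurable_sum _ fun _ _ =>
    Measurable.ite measurableSet_Ici measurable_const measurable_const

theorem measurable_blockPair (β : ℝ) (m : ℕ) {F : ℕ → ℝ → ℝ} (hF : ∀ j, Measurable (F j)) :
    Measurable fun y => F (blockIndex β m y) (blockMap β m y) := by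
  have h1 : Measurable fun p : ℕ × ℝ => F p.1 p.2 := measurable_from_prod_countable_right hF
  have h2 : Measurable fun p : ℕ × ℝ => β ^ (p.1 + 1) * (p.2 - cut β p.1) :=
    measurable_from_prod_countable_right fun j => by fun_prop
  exact h1.comp ((measurable_blockIndex β m).prodMk
    (h2.comp ((measurable_blockIndex β m).prodMk measurable_id)))

theorem measurable_blockMap (β : ℝ) (m : ℕ) : Measurable (blockMap β m) :=
  measurable_blockPair β m (F := fun _ u => u) fun _ => measurable_id

/-- Lebesgue measure on `[0, 1)`. -/
noncomputable def unitMeasure : Measure ℝ := volume.restrict (Set.Ico 0 1)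

instance : IsProbabilityMeasure unitMeasure :=
  ⟨by simp [unitMeasure]⟩

namespace IsPseudoGolden

variable {β : ℝ} {m : ℕ}

theorem pos (h : IsPseudoGolden β m) : 0 < β := one_pos.trans h.one_lt

theorem inv_pos (h : IsPseudoGolden β m) : 0 < β⁻¹ := _root_.inv_pos.2 h.pos

theorem inv_lt_one (h : IsPseudoGolden β m) : β⁻¹ < 1 := inv_lt_one_of_one_lt₀ h.one_lt

theorem mul_inv (h : IsPseudoGolden β m) : β * β⁻¹ = 1 := mul_inv_cancel₀ h.pos.ne'

theorem strictMono_cut (h : IsPseudoGolden β m) : StrictMono (cut β) :=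
  strictMono_nat_of_lt_succ fun j => by
    rw [cut_succ]
    exact lt_add_of_pos_right _ (pow_pos h.inv_pos _)

theorem cut_self (h : IsPseudoGolden β m) : cut β m = 1 := by
  have h1 : β ^ m * cut β m = β ^ m := by
    conv_rhs => rw [h.root, ← Finset.sum_range_reflect]
    rw [cut, Finset.mul_sum]
    refine Finset.sum_congr rfl fun i hi => ?_
    have hi' := Finset.mem_range.1 hi
    have : m = (m - 1 - i) + (i + 1) := by omega
    conv_lhs => rw [this]
    rw [pow_add, mul_assoc, ← mul_pow, h.mul_inv, one_pow, mul_one]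
  exact mul_left_cancel₀ (pow_pos h.pos m).ne' (by rw [h1, mul_one])

theorem blockIndex_eq (h : IsPseudoGolden β m) {j : ℕ} (hj : j < m) {y : ℝ}
    (hy : y ∈ Set.Ico (cut β j) (cut β (j + 1))) : blockIndex β m y = j := by
  have h1 : ∀ i, cut β (i + 1) ≤ y ↔ i < j := by
    intro i
    constructor
    · intro hi
      have := h.strictMono_cut.lt_iff_lt.1 (hi.trans_lt hy.2)
      omega
    · intro hi
      exact (h.strictMono_cut.monotone (by omega)).trans hy.1
  simp only [blockIndex, h1, Finset.sum_boole, Nat.cast_id]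
  have : (Finset.range (m - 1)).filter (fun i => i < j) = Finset.range j := by
    ext i
    simp only [Finset.mem_filter, Finset.mem_range]
    omega
  rw [this, Finset.card_range]

theorem exists_mem_cut (h : IsPseudoGolden β m) {y : ℝ} (hy : y ∈ Set.Ico (0 : ℝ) 1) :
    ∃ j < m, y ∈ Set.Ico (cut β j) (cut β (j + 1)) := by
  have : ∀ n, y < cut β n → ∃ j < n, y ∈ Set.Ico (cut β j) (cut β (j + 1)) := by
    intro n
    induction n with
    | zero => intro hn; rw [cut_zero] at hn; exact absurd hy.1 (not_le.2 hn)
    | succ n ih =>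
      intro hn
      by_cases hc : y < cut β n
      · obtain ⟨j, hj, hj'⟩ := ih hc
        exact ⟨j, by omega, hj'⟩
      · exact ⟨n, by omega, not_lt.1 hc, hn⟩
  exact this m (by rw [h.cut_self]; exact hy.2)

theorem mem_cut_blockIndex (h : IsPseudoGolden β m) {y : ℝ} (hy : y ∈ Set.Ico (0 : ℝ) 1) :
    y ∈ Set.Ico (cut β (blockIndex β m y)) (cut β (blockIndex β m y + 1)) := by
  obtain ⟨j, hj, hj'⟩ := h.exists_mem_cut hy
  rwa [h.blockIndex_eq hj hj']

theorem blockMap_mem (h : IsPseudoGolden β m) {y : ℝ} (hy : y ∈ Set.Ico (0 : ℝ) 1) :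
    blockMap β m y ∈ Set.Ico (0 : ℝ) 1 := by
  have h1 := h.mem_cut_blockIndex hy
  rw [cut_succ] at h1
  unfold blockMap
  set b := blockIndex β m y
  have hp := pow_pos h.pos (b + 1)
  refine ⟨mul_nonneg hp.le (sub_nonneg.2 h1.1), ?_⟩
  calc β ^ (b + 1) * (y - cut β b) < β ^ (b + 1) * β⁻¹ ^ (b + 1) := by
        have := h1.2
        gcongr
        linarith
    _ = 1 := by rw [← mul_pow, h.mul_inv, one_pow]

theorem iterate_blockMap_mem (h : IsPseudoGolden β m) {y : ℝ} (hy : y ∈ Set.Ico (0 : ℝ) 1)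
    (k : ℕ) : (blockMap β m)^[k] y ∈ Set.Ico (0 : ℝ) 1 := by
  induction k with
  | zero => exact hy
  | succ k ih => rw [Function.iterate_succ_apply']; exact h.blockMap_mem ih

/-- All m branches of `blockMap` are full, so an affine substitution on each gives the factor
q^(j+1). Invariance of Lebesgue measure and independence of the blocks both come from this formula.
-/
theorem integral_block (h : IsPseudoGolden β m) {F : ℕ → ℝ → ℝ} (hF : ∀ j, Measurable (F j))
    {M : ℝ} (hM : ∀ j y, |F j y| ≤ M) :
    ∫ y, F (blockIndex β m y) (blockMap β m y) ∂unitMeasure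
      = ∑ j ∈ Finset.range m, β⁻¹ ^ (j + 1) * ∫ y, F j y ∂unitMeasure := by
  set G : ℝ → ℝ := fun y => F (blockIndex β m y) (blockMap β m y) with hG
  have hGm : Measurable G := measurable_blockPair β m hF
  have hGi : ∀ a b, IntervalIntegrable G volume a b := by
    intro a b
    rw [intervalIntegrable_iff]
    exact Measure.integrableOn_of_bounded (M := M) (by simp) hGm.aestronglyMeasurable
      (Eventually.of_forall fun y => hM _ _)
  have hcv : ∀ (f : ℝ → ℝ) {a b : ℝ}, a ≤ b →
      ∫ y in Set.Ico a b, f y = ∫ y in a..b, f y := by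
    intro f a b hab
    rw [intervalIntegral.integral_of_le hab, integral_Ico_eq_integral_Ioc]
  have hpiece : ∀ j ∈ Finset.range m, ∫ y in (cut β j)..(cut β (j + 1)), G y
      = β⁻¹ ^ (j + 1) * ∫ y, F j y ∂unitMeasure := by
    intro j hj
    have hle := h.strictMono_cut.monotone (Nat.le_succ j)
    rw [← hcv _ hle]
    have h1 : ∫ y in Set.Ico (cut β j) (cut β (j + 1)), G y
        = ∫ y in Set.Ico (cut β j) (cut β (j + 1)),
            F j (β ^ (j + 1) * y - β ^ (j + 1) * cut β j) := by
      refine setIntegral_congr_fun measurableSet_Ico fun y hy => ?_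
      simp only [hG, blockMap, h.blockIndex_eq (Finset.mem_range.1 hj) hy, mul_sub]
    rw [h1, hcv _ hle, intervalIntegral.integral_comp_mul_sub (F j) (pow_pos h.pos _).ne',
      sub_self, ← mul_sub, cut_succ, add_sub_cancel_left, ← mul_pow, h.mul_inv, one_pow,
      smul_eq_mul, inv_pow, unitMeasure, hcv _ zero_le_one]
  have hsum := intervalIntegral.sum_integral_adjacent_intervals (μ := volume) (f := G)
    (a := cut β) (n := m) fun k _ => hGi _ _
  rw [cut_zero, h.cut_self, Finset.sum_congr rfl hpiece, ← hcv _ zero_le_one] at hsum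
  exact hsum.symm

theorem sum_inv_pow (h : IsPseudoGolden β m) :
    ∑ j ∈ Finset.range m, β⁻¹ ^ (j + 1) = 1 := h.cut_self

theorem integral_comp_blockMap (h : IsPseudoGolden β m) {f : ℝ → ℝ} (hf : Measurable f)
    {M : ℝ} (hM : ∀ y, |f y| ≤ M) :
    ∫ y, f (blockMap β m y) ∂unitMeasure = ∫ y, f y ∂unitMeasure := by
  rw [h.integral_block (F := fun _ => f) (fun _ => hf) (fun _ => hM), ← Finset.sum_mul,
    h.sum_inv_pow, one_mul]

theorem integral_comp_iterate_blockMap (h : IsPseudoGolden β m) {f : ℝ → ℝ} (hf : Measurable f)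
    {M : ℝ} (hM : ∀ y, |f y| ≤ M) (k : ℕ) :
    ∫ y, f ((blockMap β m)^[k] y) ∂unitMeasure = ∫ y, f y ∂unitMeasure := by
  induction k with
  | zero => rfl
  | succ k ih =>
    rw [← ih]
    simp_rw [Function.iterate_succ_apply]
    exact h.integral_comp_blockMap (hf.comp ((measurable_blockMap β m).iterate k))
      fun y => hM _

end IsPseudoGolden

/-! ### Independence of blocks and almost sure averages. -/

/-- `f` is a bounded observable that is independent of the orbit from the `N`-th block on. -/
structure IsBlockLocal (β : ℝ) (m N : ℕ) (f : ℝ → ℝ) : Prop where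
  measurable : Measurable f
  bounded : ∃ M, ∀ y, |f y| ≤ M
  integral_mul : ∀ ψ : ℝ → ℝ, Measurable ψ → (∃ M, ∀ y, |ψ y| ≤ M) →
    ∫ y, f y * ψ ((blockMap β m)^[N] y) ∂unitMeasure
      = (∫ y, f y ∂unitMeasure) * ∫ y, ψ y ∂unitMeasure

namespace IsPseudoGolden

variable {β : ℝ} {m : ℕ}

theorem integral_mul_comp_blockMap (h : IsPseudoGolden β m) (w : ℕ → ℝ) {W : ℝ}
    (hW : ∀ j, |w j| ≤ W) {f : ℝ → ℝ} (hf : Measurable f) {M : ℝ} (hM : ∀ y, |f y| ≤ M) :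
    ∫ y, w (blockIndex β m y) * f (blockMap β m y) ∂unitMeasure
      = (∑ j ∈ Finset.range m, β⁻¹ ^ (j + 1) * w j) * ∫ y, f y ∂unitMeasure := by
  rw [h.integral_block (F := fun j y => w j * f y) (fun j => hf.const_mul _) (M := W * M)
    fun j y => by
      rw [abs_mul]
      exact mul_le_mul (hW j) (hM y) (abs_nonneg _) ((abs_nonneg _).trans (hW j)),
    Finset.sum_mul]
  refine Finset.sum_congr rfl fun j _ => ?_
  rw [integral_const_mul, mul_assoc]

/-- Prepends one block: starting from the constant 1, every observable needed below is a product of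
block weights built this way. -/
theorem isBlockLocal_mul (h : IsPseudoGolden β m) (w : ℕ → ℝ) {W : ℝ}
    (hW : ∀ j, |w j| ≤ W) {N : ℕ} {f : ℝ → ℝ} (hf : IsBlockLocal β m N f) :
    IsBlockLocal β m (N + 1) fun y => w (blockIndex β m y) * f (blockMap β m y) := by
  obtain ⟨M, hM⟩ := hf.bounded
  refine ⟨measurable_blockPair β m (F := fun j y => w j * f y) fun j =>
    hf.measurable.const_mul _, ⟨W * M, fun y => ?_⟩, fun ψ hψ hψb => ?_⟩
  · rw [abs_mul]
    exact mul_le_mul (hW _) (hM _) (abs_nonneg _) ((abs_nonneg _).trans (hW 0))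
  · obtain ⟨K, hK⟩ := hψb
    simp_rw [Function.iterate_succ_apply, mul_assoc]
    rw [h.integral_mul_comp_blockMap w hW (f := fun y => f y * ψ ((blockMap β m)^[N] y))
      (hf.measurable.mul (hψ.comp ((measurable_blockMap β m).iterate N))) (M := M * K)
      fun y => by
        rw [abs_mul]
        exact mul_le_mul (hM y) (hK _) (abs_nonneg _) ((abs_nonneg _).trans (hM 0)),
      hf.integral_mul ψ hψ ⟨K, hK⟩, h.integral_mul_comp_blockMap w hW hf.measurable hM, mul_assoc]

theorem isBlockLocal_one : IsBlockLocal β m 0 fun _ => 1 :=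
  ⟨measurable_const, ⟨1, fun _ => by simp⟩, fun ψ _ _ => by simp⟩

theorem _root_.IsBlockLocal.congr {N : ℕ} {f g : ℝ → ℝ} (hf : IsBlockLocal β m N f)
    (hg : Measurable g) (hgb : ∃ M, ∀ y, |g y| ≤ M)
    (hfg : ∀ y ∈ Set.Ico (0 : ℝ) 1, f y = g y) : IsBlockLocal β m N g := by
  refine ⟨hg, hgb, fun ψ hψ hψb => ?_⟩
  have h1 : ∫ y, g y ∂unitMeasure = ∫ y, f y ∂unitMeasure :=
    setIntegral_congr_fun measurableSet_Ico fun y hy => (hfg y hy).symm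
  have h2 : ∫ y, g y * ψ ((blockMap β m)^[N] y) ∂unitMeasure
      = ∫ y, f y * ψ ((blockMap β m)^[N] y) ∂unitMeasure :=
    setIntegral_congr_fun measurableSet_Ico fun y hy => by simp only [hfg y hy]
  rw [h1, h2, hf.integral_mul ψ hψ hψb]

theorem isBlockLocal_length (h : IsPseudoGolden β m) :
    IsBlockLocal β m 1 fun y => (blockIndex β m y : ℝ) + 1 := by
  -- Truncating at m - 1 makes the weight bounded on all of ℕ and changes nothing at an actual block
  -- index.
  refine (h.isBlockLocal_mul (fun j => ((min j (m - 1) : ℕ) : ℝ) + 1) (W := (m - 1 : ℕ) + 1)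
    (fun j => ?_) isBlockLocal_one).congr ?_ ⟨(m - 1 : ℕ) + 1, fun y => ?_⟩ fun y _ => ?_
  · rw [abs_of_nonneg (by positivity)]
    gcongr
    exact min_le_right _ _
  · exact ((measurable_from_nat (f := fun j : ℕ => (j : ℝ))).comp
      (measurable_blockIndex β m)).add_const 1
  · rw [abs_of_nonneg (by positivity)]
    gcongr
    exact blockIndex_le β m y
  · simp only [mul_one, min_eq_left (blockIndex_le β m y)]

theorem integral_length (h : IsPseudoGolden β m) :
    ∫ y, ((blockIndex β m y : ℝ) + 1) ∂unitMeasure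
      = ∑ j ∈ Finset.range m, β⁻¹ ^ (j + 1) * (j + 1) := by
  have := h.integral_mul_comp_blockMap (fun j => ((min j (m - 1) : ℕ) : ℝ) + 1)
    (W := (m - 1 : ℕ) + 1) (fun j => ?_) (f := fun _ => 1) measurable_const (M := 1) (by simp)
  · simp only [mul_one, min_eq_left (blockIndex_le β m _), integral_const, probReal_univ,
      smul_eq_mul] at this
    rw [this]
    refine Finset.sum_congr rfl fun j hj => ?_
    rw [min_eq_left (by have := Finset.mem_range.1 hj; omega)]
  · rw [abs_of_nonneg (by positivity)]
    gcongr
    exact min_le_right _ _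

theorem cut_one (β : ℝ) : cut β 1 = β⁻¹ := by simp [cut]

theorem blockIndex_eq_zero_iff (h : IsPseudoGolden β m) {y : ℝ} (hy : y ∈ Set.Ico (0 : ℝ) 1) :
    blockIndex β m y = 0 ↔ y < β⁻¹ := by
  have h1 := h.mem_cut_blockIndex hy
  rw [← cut_one]
  constructor
  · intro h0
    rw [h0] at h1
    exact h1.2
  · intro h0
    have := h.strictMono_cut.lt_iff_lt.1 (h1.1.trans_lt h0)
    omega

theorem blockMap_of_lt (h : IsPseudoGolden β m) {y : ℝ} (hy : y ∈ Set.Ico (0 : ℝ) 1)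
    (hy' : y < β⁻¹) : blockMap β m y = β * y := by
  rw [blockMap, (h.blockIndex_eq_zero_iff hy).2 hy', cut_zero]
  simp

/-- A point of [0, 1) is below q^r exactly when its first r blocks are single zeros; the induction
removes one such block at a time. -/
theorem isBlockLocal_lt (h : IsPseudoGolden β m) (r : ℕ) :
    IsBlockLocal β m r fun y => if y < β⁻¹ ^ r then 1 else 0 := by
  have hm : ∀ r, Measurable fun y : ℝ => if y < β⁻¹ ^ r then (1 : ℝ) else 0 := fun r =>
    Measurable.ite measurableSet_Iio measurable_const measurable_const
  have hb : ∀ r, ∃ M, ∀ y : ℝ, |if y < β⁻¹ ^ r then (1 : ℝ) else 0| ≤ M := fun r =>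
    ⟨1, fun y => by split_ifs <;> simp⟩
  induction r with
  | zero =>
    refine isBlockLocal_one.congr (hm 0) (hb 0) fun y hy => ?_
    simp [hy.2]
  | succ r ih =>
    refine (h.isBlockLocal_mul (fun j => if j = 0 then 1 else 0) (W := 1)
      (fun j => by split_ifs <;> simp) ih).congr (hm _) (hb _) fun y hy => ?_
    by_cases hlt : y < β⁻¹
    · simp only [(h.blockIndex_eq_zero_iff hy).2 hlt, h.blockMap_of_lt hy hlt, if_true, one_mul]
      have : β * y < β⁻¹ ^ r ↔ y < β⁻¹ ^ (r + 1) := by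
        rw [← mul_lt_mul_iff_right₀ h.pos (b := y), pow_succ', ← mul_assoc, h.mul_inv, one_mul]
      simp only [this]
    · have h0 : blockIndex β m y ≠ 0 := fun h0 => hlt ((h.blockIndex_eq_zero_iff hy).1 h0)
      have h1 : ¬ y < β⁻¹ ^ (r + 1) := fun h1 => hlt (h1.trans_le
        (by simpa using pow_le_pow_of_le_one h.inv_pos.le h.inv_lt_one.le (Nat.le_add_left 1 r)))
      simp only [if_neg h0, if_neg h1, zero_mul]

theorem integral_lt (h : IsPseudoGolden β m) (r : ℕ) :
    ∫ y, (if y < β⁻¹ ^ r then (1 : ℝ) else 0) ∂unitMeasure = β⁻¹ ^ r := by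
  have h1 : (fun y : ℝ => if y < β⁻¹ ^ r then (1 : ℝ) else 0)
      = (Set.Iio (β⁻¹ ^ r)).indicator fun _ => 1 := by
    ext y
    simp [Set.indicator_apply]
  have h2 : Set.Iio (β⁻¹ ^ r) ∩ Set.Ico 0 1 = Set.Ico 0 (β⁻¹ ^ r) := by
    ext y
    have := pow_le_one₀ h.inv_pos.le h.inv_lt_one.le (n := r)
    simp only [Set.mem_inter_iff, Set.mem_Iio, Set.mem_Ico]
    constructor
    · rintro ⟨h1, h2, -⟩; exact ⟨h2, h1⟩
    · rintro ⟨h1, h2⟩; exact ⟨h2, h1, h2.trans_le this⟩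
  rw [h1, integral_indicator measurableSet_Iio, unitMeasure,
    Measure.restrict_restrict measurableSet_Iio, h2]
  have := (pow_pos h.inv_pos r).le
  simp [this, -inv_pow]

end IsPseudoGolden

/-- The indicator function of the points whose first block contains a one and is followed by
at least `r` zeros. -/
noncomputable def zeroRun (β : ℝ) (m r : ℕ) (y : ℝ) : ℝ :=
  (if blockIndex β m y = 0 then 0 else 1) * if blockMap β m y < β⁻¹ ^ r then 1 else 0

namespace IsPseudoGolden

variable {β : ℝ} {m : ℕ}

theorem isBlockLocal_zeroRun (h : IsPseudoGolden β m) (r : ℕ) :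
    IsBlockLocal β m (r + 1) (zeroRun β m r) :=
  h.isBlockLocal_mul (fun j => if j = 0 then 0 else 1) (W := 1)
    (fun j => by split_ifs <;> simp) (h.isBlockLocal_lt r)

/-- A block containing a one has probability 1 - q, and each of the r further zeros, being a block
of its own, has probability q. -/
theorem integral_zeroRun (h : IsPseudoGolden β m) (r : ℕ) :
    ∫ y, zeroRun β m r y ∂unitMeasure = (1 - β⁻¹) * β⁻¹ ^ r := by
  obtain ⟨M, hM⟩ := (h.isBlockLocal_lt r).bounded
  have h1 := h.integral_mul_comp_blockMap (fun j => if j = 0 then 0 else 1) (W := 1)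
    (fun j => by split_ifs <;> simp) (h.isBlockLocal_lt r).measurable hM
  unfold zeroRun
  rw [h1, h.integral_lt]
  congr 1
  have h2 := h.sum_inv_pow
  obtain ⟨k, rfl⟩ : ∃ k, m = k + 1 := ⟨m - 1, by have := h.two_le; omega⟩
  rw [Finset.sum_range_succ'] at h2 ⊢
  simp only [Nat.add_eq_zero_iff, one_ne_zero, and_false, if_false, if_true, mul_one, mul_zero,
    zero_add, pow_one, add_zero] at h2 ⊢
  linarith

/-- Centred observables at least N blocks apart are orthogonal, and deterministic weights keep them
so. The weights serve to select blocks. -/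
theorem ae_tendsto_weighted_average (h : IsPseudoGolden β m) {N : ℕ} {f : ℝ → ℝ}
    (hf : IsBlockLocal β m N f) {a : ℕ → ℝ} (ha : ∀ k, |a k| ≤ 1) {t : ℝ}
    (hat : Tendsto (fun n : ℕ => (∑ k ∈ Finset.range n, a k) / (n : ℝ)) atTop (𝓝 t)) :
    ∀ᵐ x ∂unitMeasure, Tendsto (fun n : ℕ =>
      (∑ k ∈ Finset.range n, a k * f ((blockMap β m)^[k] x)) / (n : ℝ)) atTop
        (𝓝 (t * ∫ y, f y ∂unitMeasure)) := by
  obtain ⟨M, hM⟩ := hf.bounded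
  set e := ∫ y, f y ∂unitMeasure with he
  set S := blockMap β m with hS
  have hSm : ∀ k, Measurable S^[k] := fun k => (measurable_blockMap β m).iterate k
  have hM' : ∀ y, |f y - e| ≤ M + |e| := fun y => (abs_sub _ _).trans (add_le_add_left (hM y) _)
  have hint : ∀ {g : ℝ → ℝ}, Measurable g → ∀ {K : ℝ}, (∀ y, |g y| ≤ K) →
      Integrable g unitMeasure := fun hg K hK =>
    Integrable.of_bound hg.aestronglyMeasurable K (Eventually.of_forall hK)
  -- Split d as N + l: the factor at time d is a function ψ of the orbit after N blocks, with
  -- integral 0 by invariance.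
  have hcov : ∀ d, N ≤ d → ∫ y, (f y - e) * (f (S^[d] y) - e) ∂unitMeasure = 0 := by
    intro d hd
    obtain ⟨l, rfl⟩ := Nat.exists_eq_add_of_le' hd
    set ψ : ℝ → ℝ := fun y => f (S^[l] y) - e with hψ
    have hψm : Measurable ψ := (hf.measurable.comp (hSm l)).sub_const e
    have hψb : ∀ y, |ψ y| ≤ M + |e| := fun y => hM' _
    have hψ0 : ∫ y, ψ y ∂unitMeasure = 0 := by
      have h1 : ∫ y, ψ y ∂unitMeasure = ∫ y, f (S^[l] y) ∂unitMeasure - ∫ _, e ∂unitMeasure :=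
        integral_sub (hint (hf.measurable.comp (hSm l)) fun y => hM _) (integrable_const e)
      rw [h1, h.integral_comp_iterate_blockMap hf.measurable hM l]
      simp [he]
    have h1 := hf.integral_mul ψ hψm ⟨_, hψb⟩
    have h2 := h.integral_comp_iterate_blockMap hψm hψb N
    rw [hψ0] at h1 h2
    have h3 : ∀ y, (f y - e) * (f (S^[l + N] y) - e) = f y * ψ (S^[N] y) - e * ψ (S^[N] y) := by
      intro y
      rw [Function.iterate_add_apply, hψ, sub_mul]
    simp_rw [h3]
    rw [integral_sub, h1, integral_const_mul, h2]
    · ring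
    · refine hint (hf.measurable.mul (hψm.comp (hSm N))) (K := M * (M + |e|)) fun y => ?_
      rw [abs_mul]
      exact mul_le_mul (hM y) (hψb _) (abs_nonneg _) ((abs_nonneg _).trans (hM 0))
    · exact (hint (hψm.comp (hSm N)) fun y => hψb _).const_mul e
  have hmain := ae_tendsto_average_of_orthogonal (μ := unitMeasure)
    (Y := fun k x => a k * (f (S^[k] x) - e))
    (fun k => ((hf.measurable.comp (hSm k)).sub_const e).const_mul _) (M := M + |e|) (N := N)
    (fun k x => by
      rw [abs_mul]
      exact (mul_le_of_le_one_left (abs_nonneg _) (ha k)).trans (hM' _))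
    (fun j k hjk => by
      obtain ⟨d, rfl⟩ := Nat.exists_eq_add_of_le' (le_of_add_le_left hjk)
      have h1 : ∀ x, a j * (f (S^[j] x) - e) * (a (d + j) * (f (S^[d + j] x) - e))
          = a j * a (d + j) * ((f (S^[j] x) - e) * (f (S^[d] (S^[j] x)) - e)) := by
        intro x
        rw [Function.iterate_add_apply]
        ring
      simp_rw [h1]
      rw [integral_const_mul, h.integral_comp_iterate_blockMap
        (f := fun y => (f y - e) * (f (S^[d] y) - e))
        ((hf.measurable.sub_const e).mul ((hf.measurable.comp (hSm d)).sub_const e))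
        (M := (M + |e|) * (M + |e|)) (fun y => by
          rw [abs_mul]
          exact mul_le_mul (hM' y) (hM' _) (abs_nonneg _) ((abs_nonneg _).trans (hM' 0))) j,
        hcov d (by omega), mul_zero])
  filter_upwards [hmain] with x hx
  have := hx.add (hat.mul_const e)
  rw [zero_add] at this
  refine this.congr fun n => ?_
  rw [div_mul_eq_mul_div, ← add_div, Finset.sum_mul, ← Finset.sum_add_distrib]
  congr 1
  exact Finset.sum_congr rfl fun k _ => by ring

end IsPseudoGolden

/-! ### Carries in digit sequences. -/

/-- The sequence `c`, delayed by `i`. -/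
def lag (c : ℕ → ℕ) (i n : ℕ) : ℕ := if i ≤ n then c (n - i) else 0

theorem sum_range_lag (c : ℕ → ℕ) (i N : ℕ) :
    ∑ n ∈ Finset.range N, lag c i n = ∑ n ∈ Finset.range (N - i), c n := by
  induction N with
  | zero => simp
  | succ N ih =>
    rw [Finset.sum_range_succ, ih, lag]
    split_ifs with h
    · rw [Nat.succ_sub h, Finset.sum_range_succ]
    · rw [Nat.sub_eq_zero_of_le (by omega : N ≤ i), Nat.sub_eq_zero_of_le (by omega : N + 1 ≤ i),
        add_zero]

/-- The sequence obtained from `g` by replacing `1 0 ⋯ 0` by `0 1 ⋯ 1` (with `m` zeros and ones)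
at every place marked by `c`. -/
def carry (m : ℕ) (g c : ℕ → ℕ) (n : ℕ) : ℕ :=
  g n + ∑ i ∈ Finset.range m, lag c (i + 1) n - c n

/-- The places marked by `c` in the digit sequence `g` are such that `carry m g c` arises from
successive replacements of `1 0 ⋯ 0` by `0 1 ⋯ 1`. -/
structure IsCarryMark (m : ℕ) (g c : ℕ → ℕ) : Prop where
  digit_le : ∀ n, g n ≤ 1
  mark_le : ∀ n, c n ≤ 1
  zero_of_mark : ∀ n i, c n = 1 → 1 ≤ i → i ≤ m → g (n + i) = 0
  one_or_mark : ∀ n, c n = 1 → g n = 1 ∨ (m ≤ n ∧ c (n - m) = 1)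

namespace IsCarryMark

variable {m : ℕ} {g c : ℕ → ℕ}

/-- If n < n' < n + m are both marked, then `g n'` is 0, so n' - m is marked too; but n' - m and n
are less than m apart, which the induction hypothesis excludes. -/
theorem add_le_of_lt (h : IsCarryMark m g c) (n' : ℕ) :
    ∀ n < n', c n = 1 → c n' = 1 → n + m ≤ n' := by
  induction n' using Nat.strong_induction_on with
  | _ n' ih =>
    intro n hn hcn hcn'
    by_contra! hlt
    have hg : g n' = 0 := by
      have := h.zero_of_mark n (n' - n) hcn (by omega) (by omega)
      rwa [Nat.add_sub_cancel' hn.le] at this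
    rcases h.one_or_mark n' hcn' with h1 | ⟨h1, h2⟩
    · omega
    · have := ih n hn (n' - m) (by omega) h2 hcn
      omega

/-- Marks are at least m apart, so at most one of the m places before n is marked, and then `g n` is
0. Hence the digit stays at most 1 and the natural subtraction in `carry` never truncates. -/
theorem carry_spec (h : IsCarryMark m g c) (hm : 1 ≤ m) (n : ℕ) :
    carry m g c n + c n = g n + ∑ i ∈ Finset.range m, lag c (i + 1) n ∧
      carry m g c n ≤ 1 ∧ (c n = 1 → carry m g c n = 0) := by
  have hc := h.mark_le n
  have hg := h.digit_le n
  unfold carry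
  by_cases h0 : ∑ i ∈ Finset.range m, lag c (i + 1) n = 0
  · have : c n = 1 → g n = 1 := by
      intro h1
      refine (h.one_or_mark n h1).resolve_right fun h2 => ?_
      have h3 := Finset.sum_eq_zero_iff.1 h0 (m - 1) (Finset.mem_range.2 (by omega))
      rw [lag, Nat.sub_add_cancel hm, if_pos h2.1] at h3
      omega
    omega
  · obtain ⟨i, hi, hi0⟩ := Finset.exists_ne_zero_of_sum_ne_zero h0
    have him := Finset.mem_range.1 hi
    have hin : i + 1 ≤ n := by
      by_contra hcon
      exact hi0 (if_neg hcon)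
    have hval : ∀ k, lag c (k + 1) n ≠ 0 → k + 1 ≤ n ∧ c (n - (k + 1)) = 1 := by
      intro k hk
      unfold lag at hk
      split_ifs at hk with h4
      · exact ⟨h4, by have := h.mark_le (n - (k + 1)); omega⟩
      · exact absurd rfl hk
    have hci := (hval i hi0).2
    have hgn : g n = 0 := by
      have := h.zero_of_mark _ (i + 1) hci (by omega) (by omega)
      rwa [Nat.sub_add_cancel hin] at this
    have hsum : ∑ i ∈ Finset.range m, lag c (i + 1) n = 1 := by
      rw [Finset.sum_eq_single i]
      · rw [lag, if_pos hin, hci]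
      · intro k hk hki
        by_contra hk0
        obtain ⟨hkn, hck⟩ := hval k hk0
        have hkm := Finset.mem_range.1 hk
        rcases lt_or_gt_of_ne hki with hlt | hlt
        · have := h.add_le_of_lt _ _ (by omega) hci hck
          omega
        · have := h.add_le_of_lt _ _ (by omega) hck hci
          omega
      · exact fun hcon => absurd hi hcon
    omega

/-- If the marks sum to C in base β, delaying them by i gives q^i C. The added ones thus contribute
(q + ... + q^m) C = C, exactly what the removed ones take away. -/
theorem hasSum_carry (h : IsCarryMark m g c) {β x : ℝ} (hβ : IsPseudoGolden β m)
    (hx : HasSum (fun n : ℕ => (g n : ℝ) / β ^ (n + 1)) x) :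
    HasSum (fun n : ℕ => (carry m g c n : ℝ) / β ^ (n + 1)) x := by
  have hm : 1 ≤ m := one_le_two.trans hβ.two_le
  have hsum : Summable fun n : ℕ => (c n : ℝ) / β ^ (n + 1) := by
    refine Summable.of_nonneg_of_le (fun n => by have := hβ.pos; positivity) (fun n => ?_)
      ((summable_nat_add_iff 1).2 (summable_geometric_of_lt_one hβ.inv_pos.le hβ.inv_lt_one))
    rw [inv_pow, div_eq_mul_inv]
    refine mul_le_of_le_one_left (by have := hβ.pos; positivity) ?_
    exact_mod_cast h.mark_le n
  obtain ⟨C, hC⟩ := hsum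
  have hlag : ∀ i, HasSum (fun n : ℕ => (lag c i n : ℝ) / β ^ (n + 1)) (β⁻¹ ^ i * C) := by
    intro i
    have h0 : ∑ n ∈ Finset.range i, (lag c i n : ℝ) / β ^ (n + 1) = 0 :=
      Finset.sum_eq_zero fun n hn => by
        rw [lag, if_neg (by have := Finset.mem_range.1 hn; omega)]
        simp
    have h1 := (hasSum_nat_add_iff (f := fun n : ℕ => (lag c i n : ℝ) / β ^ (n + 1)) i
      (g := β⁻¹ ^ i * C)).1
    rw [h0, add_zero] at h1
    refine h1 ((hC.mul_left (β⁻¹ ^ i)).congr_fun fun n => ?_)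
    rw [lag, if_pos (Nat.le_add_left i n), Nat.add_sub_cancel, inv_pow, add_right_comm n i 1,
      pow_add β (n + 1) i]
    have := hβ.pos
    field_simp
  have := (hx.add (hasSum_sum fun i (_ : i ∈ Finset.range m) => hlag (i + 1))).sub hC
  rw [← Finset.sum_mul, hβ.sum_inv_pow, one_mul, add_sub_cancel_right] at this
  refine this.congr_fun fun n => ?_
  have h2 := (h.carry_spec hm n).1
  have h3 : (carry m g c n : ℝ) + c n = g n + ∑ i ∈ Finset.range m, (lag c (i + 1) n : ℝ) := by
    exact_mod_cast h2
  rw [← Finset.sum_div, ← add_div, ← sub_div, ← h3, add_sub_cancel_right]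

end IsCarryMark

theorem card_zeros_eq {ε : ℕ → ℕ} (hε : ∀ n, ε n ≤ 1) (N : ℕ) :
    (((Finset.range N).filter fun i => ε i = 0).card : ℝ)
      = N - ∑ n ∈ Finset.range N, (ε n : ℝ) := by
  rw [Finset.card_filter]
  push_cast
  rw [eq_sub_iff_add_eq, ← Finset.sum_add_distrib]
  rw [Finset.sum_congr rfl (g := fun _ => (1 : ℝ)) fun n _ => ?_]
  · simp
  · have := hε n
    interval_cases ε n <;> simp

namespace IsCarryMark

variable {m : ℕ} {g c : ℕ → ℕ}

/-- Each mark removes one digit 1 and creates m of them, up to a bounded delay that does not affect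
the density. -/
theorem hasDigitFreq_carry (h : IsCarryMark m g c) (hm : 1 ≤ m) {z D : ℝ}
    (hg : HasDigitFreq g 0 z)
    (hc : Tendsto (fun N : ℕ => (∑ n ∈ Finset.range N, (c n : ℝ)) / N) atTop (𝓝 D)) :
    HasDigitFreq (carry m g c) 0 (z - (m - 1) * D) := by
  have h1 := (hg.add hc).sub (tendsto_finsetSum (Finset.range m) fun i _ =>
    tendsto_shift_div hc (i + 1))
  rw [Finset.sum_const, Finset.card_range, nsmul_eq_mul] at h1
  unfold HasDigitFreq
  rw [show z - (m - 1) * D = z + D - m * D by ring]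
  refine h1.congr fun N => ?_
  rw [card_zeros_eq h.digit_le, card_zeros_eq fun n => (h.carry_spec hm n).2.1,
    ← Finset.sum_div, ← add_div, ← sub_div]
  congr 1
  have h2 : ∑ n ∈ Finset.range N, (carry m g c n + c n)
      = ∑ n ∈ Finset.range N, (g n + ∑ i ∈ Finset.range m, lag c (i + 1) n) :=
    Finset.sum_congr rfl fun n _ => (h.carry_spec hm n).1
  rw [Finset.sum_add_distrib, Finset.sum_add_distrib, Finset.sum_comm] at h2
  simp_rw [sum_range_lag] at h2
  have h3 : ∑ n ∈ Finset.range N, (carry m g c n : ℝ) + ∑ n ∈ Finset.range N, (c n : ℝ)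
      = ∑ n ∈ Finset.range N, (g n : ℝ)
        + ∑ i ∈ Finset.range m, ∑ n ∈ Finset.range (N - (i + 1)), (c n : ℝ) := by
    exact_mod_cast h2
  linarith

end IsCarryMark

/-! ### Greedy digits, blocks and marks. -/

/-- The greedy `β`-transformation on `[0, 1)`, for `β ∈ (1, 2)`. -/
noncomputable def greedyMap (β x : ℝ) : ℝ := if x < β⁻¹ then β * x else β * x - 1

/-- The greedy digits of `x`. -/
noncomputable def greedyDigit (β x : ℝ) (n : ℕ) : ℕ :=
  if (greedyMap β)^[n] x < β⁻¹ then 0 else 1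

/-- The number of zeros among the first `n` greedy digits of `x`. -/
noncomputable def zeroCount (β x : ℝ) (n : ℕ) : ℕ :=
  ∑ i ∈ Finset.range n, (1 - greedyDigit β x i)

/-- The place where the `k`-th block of the greedy expansion of `x` starts. -/
noncomputable def blockStart (β : ℝ) (m : ℕ) (x : ℝ) (k : ℕ) : ℕ :=
  ∑ i ∈ Finset.range k, (blockIndex β m ((blockMap β m)^[i] x) + 1)

open Classical in
/-- The places where the greedy expansion of `x` has a one followed by at least `r + 1` zeros, in
a block whose number is selected by `sel`. -/
noncomputable def runMark (β : ℝ) (r : ℕ) (sel : ℕ → Prop) (x : ℝ) (n : ℕ) : ℕ :=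
  if (β⁻¹ ≤ (greedyMap β)^[n] x ∧ (greedyMap β)^[n + 1] x < β⁻¹ ^ (r + 1)) ∧
    sel (zeroCount β x n) then 1 else 0

/-- In the selected blocks, mark the final `1` if it is followed by `m` zeros, and also the last
of these zeros if `m` more of them follow. -/
noncomputable def blockMark (β : ℝ) (m : ℕ) (sel : ℕ → Prop) (x : ℝ) (n : ℕ) : ℕ :=
  runMark β (m - 1) sel x n + lag (runMark β (2 * m - 1) sel x) m n

theorem greedyDigit_le_one (β x : ℝ) (n : ℕ) : greedyDigit β x n ≤ 1 := by
  unfold greedyDigit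
  split_ifs <;> simp

theorem runMark_le_one (β : ℝ) (r : ℕ) (sel : ℕ → Prop) (x : ℝ) (n : ℕ) :
    runMark β r sel x n ≤ 1 := by
  unfold runMark
  split_ifs <;> simp

theorem zeroCount_le (β x : ℝ) (n : ℕ) : zeroCount β x n ≤ n := by
  unfold zeroCount
  refine (Finset.sum_le_card_nsmul _ _ 1 fun j _ => Nat.sub_le _ _).trans (by simp)

theorem zeroCount_add (β x : ℝ) (n i : ℕ) :
    zeroCount β x (n + i) = zeroCount β x n + zeroCount β ((greedyMap β)^[n] x) i := by
  unfold zeroCount greedyDigit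
  rw [Finset.sum_range_add]
  simp_rw [add_comm n, Function.iterate_add_apply]

theorem blockStart_succ (β : ℝ) (m : ℕ) (x : ℝ) (k : ℕ) : blockStart β m x (k + 1)
    = blockStart β m x k + (blockIndex β m ((blockMap β m)^[k] x) + 1) :=
  Finset.sum_range_succ _ _

theorem strictMono_blockStart (β : ℝ) (m : ℕ) (x : ℝ) : StrictMono (blockStart β m x) :=
  strictMono_nat_of_lt_succ fun k => by rw [blockStart_succ]; omega

namespace IsPseudoGolden

variable {β : ℝ} {m : ℕ}

theorem greedyMap_mem (h : IsPseudoGolden β m) {x : ℝ} (hx : x ∈ Set.Ico (0 : ℝ) 1) :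
    greedyMap β x ∈ Set.Ico (0 : ℝ) 1 := by
  have hβ := h.pos
  have h2 := h.lt_two
  unfold greedyMap
  split_ifs with hlt
  · refine ⟨mul_nonneg hβ.le hx.1, ?_⟩
    calc β * x < β * β⁻¹ := by gcongr
      _ = 1 := h.mul_inv
  · have h1 : β * β⁻¹ ≤ β * x := by gcongr; exact not_lt.1 hlt
    rw [h.mul_inv] at h1
    exact ⟨by linarith, by nlinarith [hx.2]⟩

theorem iterate_greedyMap_mem (h : IsPseudoGolden β m) {x : ℝ} (hx : x ∈ Set.Ico (0 : ℝ) 1)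
    (n : ℕ) : (greedyMap β)^[n] x ∈ Set.Ico (0 : ℝ) 1 := by
  induction n with
  | zero => exact hx
  | succ n ih => rw [Function.iterate_succ_apply']; exact h.greedyMap_mem ih

theorem hasSum_greedyDigit (h : IsPseudoGolden β m) {x : ℝ} (hx : x ∈ Set.Ico (0 : ℝ) 1) :
    HasSum (fun n : ℕ => (greedyDigit β x n : ℝ) / β ^ (n + 1)) x := by
  have hβ := h.pos
  rw [hasSum_iff_tendsto_nat_of_nonneg fun n => by positivity]
  have hpart : ∀ N, ∑ n ∈ Finset.range N, (greedyDigit β x n : ℝ) / β ^ (n + 1)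
      = x - (greedyMap β)^[N] x * β⁻¹ ^ N := by
    intro N
    induction N with
    | zero => simp
    | succ N ih =>
      rw [Finset.sum_range_succ, ih, Function.iterate_succ_apply', greedyDigit, greedyMap]
      split_ifs with hlt
      · push_cast; simp only [inv_pow]; field_simp; ring
      · push_cast; simp only [inv_pow]; field_simp; ring
  simp_rw [hpart]
  have h0 : Tendsto (fun N : ℕ => (greedyMap β)^[N] x * β⁻¹ ^ N) atTop (𝓝 0) := by
    refine squeeze_zero (fun N => mul_nonneg (h.iterate_greedyMap_mem hx N).1
      (pow_nonneg h.inv_pos.le _)) (fun N => ?_)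
      (tendsto_pow_atTop_nhds_zero_of_lt_one h.inv_pos.le h.inv_lt_one)
    exact mul_le_of_le_one_left (pow_nonneg h.inv_pos.le _) (h.iterate_greedyMap_mem hx N).2.le
  simpa using h0.const_sub x

theorem iterate_greedyMap_of_cut_le (h : IsPseudoGolden β m) {y : ℝ} {i : ℕ}
    (hi : cut β i ≤ y) : (greedyMap β)^[i] y = β ^ i * (y - cut β i) := by
  induction i with
  | zero => simp [cut_zero]
  | succ i ih =>
    have hle := (h.strictMono_cut.monotone (Nat.le_succ i)).trans hi
    rw [cut_succ] at hi ⊢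
    have hp := pow_pos h.pos i
    have hpp : β ^ i * β⁻¹ ^ i = 1 := by rw [← mul_pow, h.mul_inv, one_pow]
    have h1 : β⁻¹ ≤ β ^ i * (y - cut β i) := by
      calc β⁻¹ = β ^ i * β⁻¹ ^ (i + 1) := by rw [pow_succ, ← mul_assoc, hpp, one_mul]
        _ ≤ _ := by gcongr; linarith
    rw [Function.iterate_succ_apply', ih hle, greedyMap, if_neg (not_lt.2 h1), pow_succ, pow_succ]
    linear_combination β * β⁻¹ * hpp + h.mul_inv

theorem le_iterate_greedyMap (h : IsPseudoGolden β m) {y : ℝ} (hy : y ∈ Set.Ico (0 : ℝ) 1) {i : ℕ}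
    (hi : i < blockIndex β m y) : β⁻¹ ≤ (greedyMap β)^[i] y := by
  have h1 := (h.strictMono_cut.monotone hi).trans (h.mem_cut_blockIndex hy).1
  have h2 := (h.strictMono_cut.monotone (Nat.le_succ i)).trans h1
  rw [cut_succ] at h1
  rw [h.iterate_greedyMap_of_cut_le h2]
  have hp := pow_pos h.pos i
  have hpp : β ^ i * β⁻¹ ^ i = 1 := by rw [← mul_pow, h.mul_inv, one_pow]
  calc β⁻¹ = β ^ i * β⁻¹ ^ (i + 1) := by rw [pow_succ, ← mul_assoc, hpp, one_mul]
    _ ≤ _ := by gcongr; linarith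

theorem iterate_greedyMap_blockIndex (h : IsPseudoGolden β m) {y : ℝ}
    (hy : y ∈ Set.Ico (0 : ℝ) 1) :
    (greedyMap β)^[blockIndex β m y] y = β⁻¹ * blockMap β m y := by
  rw [h.iterate_greedyMap_of_cut_le (h.mem_cut_blockIndex hy).1, blockMap, pow_succ']
  rw [← mul_assoc, ← mul_assoc, inv_mul_cancel₀ h.pos.ne', one_mul]

theorem iterate_greedyMap_blockIndex_lt (h : IsPseudoGolden β m) {y : ℝ}
    (hy : y ∈ Set.Ico (0 : ℝ) 1) : (greedyMap β)^[blockIndex β m y] y < β⁻¹ := by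
  rw [h.iterate_greedyMap_blockIndex hy]
  exact mul_lt_of_lt_one_right h.inv_pos (h.blockMap_mem hy).2

theorem iterate_greedyMap_blockIndex_succ (h : IsPseudoGolden β m) {y : ℝ}
    (hy : y ∈ Set.Ico (0 : ℝ) 1) :
    (greedyMap β)^[blockIndex β m y + 1] y = blockMap β m y := by
  rw [Function.iterate_succ_apply', greedyMap, if_pos (h.iterate_greedyMap_blockIndex_lt hy),
    h.iterate_greedyMap_blockIndex hy, ← mul_assoc, h.mul_inv, one_mul]

theorem zeroCount_block (h : IsPseudoGolden β m) {y : ℝ} (hy : y ∈ Set.Ico (0 : ℝ) 1) {i : ℕ}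
    (hi : i ≤ blockIndex β m y) : zeroCount β y i = 0 := by
  refine Finset.sum_eq_zero fun j hj => ?_
  have := h.le_iterate_greedyMap hy ((Finset.mem_range.1 hj).trans_le hi)
  rw [greedyDigit, if_neg (not_lt.2 this), Nat.sub_self]

theorem zeroCount_block_succ (h : IsPseudoGolden β m) {y : ℝ} (hy : y ∈ Set.Ico (0 : ℝ) 1) :
    zeroCount β y (blockIndex β m y + 1) = 1 := by
  have := h.zeroCount_block hy le_rfl
  unfold zeroCount at this ⊢
  rw [Finset.sum_range_succ, this, greedyDigit, if_pos (h.iterate_greedyMap_blockIndex_lt hy)]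

theorem iterate_greedyMap_blockStart (h : IsPseudoGolden β m) {x : ℝ}
    (hx : x ∈ Set.Ico (0 : ℝ) 1) (k : ℕ) :
    (greedyMap β)^[blockStart β m x k] x = (blockMap β m)^[k] x := by
  induction k with
  | zero => rfl
  | succ k ih =>
    rw [blockStart_succ, add_comm, Function.iterate_add_apply, ih,
      h.iterate_greedyMap_blockIndex_succ (h.iterate_blockMap_mem hx k),
      Function.iterate_succ_apply']

/-- Every block ends with its only zero, so the number of zeros read so far is the number of the
current block; this is why `runMark` evaluates `sel` at `zeroCount`. -/
theorem zeroCount_blockStart (h : IsPseudoGolden β m) {x : ℝ}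
    (hx : x ∈ Set.Ico (0 : ℝ) 1) (k : ℕ) : zeroCount β x (blockStart β m x k) = k := by
  induction k with
  | zero => rfl
  | succ k ih =>
    rw [blockStart_succ, zeroCount_add, ih, h.iterate_greedyMap_blockStart hx,
      h.zeroCount_block_succ (h.iterate_blockMap_mem hx k)]

open Classical in
-- Only the last 1 of a block can be followed by a zero. The block's own zero accounts for the
-- exponent r + 1 on the left against r further zeros in `zeroRun`.
theorem sum_block_eq_zeroRun (h : IsPseudoGolden β m) {y : ℝ} (hy : y ∈ Set.Ico (0 : ℝ) 1)
    (r : ℕ) : ∑ i ∈ Finset.range (blockIndex β m y + 1),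
      (if β⁻¹ ≤ (greedyMap β)^[i] y ∧ (greedyMap β)^[i + 1] y < β⁻¹ ^ (r + 1)
        then (1 : ℝ) else 0) = zeroRun β m r y := by
  rw [Finset.sum_range_succ, if_neg (fun hc => not_lt.2 hc.1 (h.iterate_greedyMap_blockIndex_lt hy)),
    add_zero, zeroRun]
  rcases hb : blockIndex β m y with _ | b
  · simp
  · rw [Finset.sum_range_succ, Finset.sum_eq_zero, if_neg (Nat.succ_ne_zero b), zero_add, one_mul]
    · have h1 := h.iterate_greedyMap_blockIndex hy
      rw [hb] at h1
      have h2 : β⁻¹ * blockMap β m y < β⁻¹ ^ (r + 1) ↔ blockMap β m y < β⁻¹ ^ r := by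
        rw [pow_succ', mul_lt_mul_iff_right₀ h.inv_pos]
      rw [h1]
      simp only [h2, h.le_iterate_greedyMap hy (i := b) (by omega), true_and]
    · intro i hi
      have hi' := Finset.mem_range.1 hi
      have h1 := h.le_iterate_greedyMap hy (i := i + 1) (by omega)
      have h2 : β⁻¹ ^ (r + 1) ≤ β⁻¹ := by
        simpa using pow_le_pow_of_le_one h.inv_pos.le h.inv_lt_one.le (Nat.le_add_left 1 r)
      exact if_neg fun hc => not_lt.2 (h2.trans h1) hc.2

open Classical in
theorem sum_runMark_blockStart (h : IsPseudoGolden β m) {x : ℝ} (hx : x ∈ Set.Ico (0 : ℝ) 1)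
    (r : ℕ) (sel : ℕ → Prop) (K : ℕ) :
    ∑ n ∈ Finset.range (blockStart β m x K), (runMark β r sel x n : ℝ)
      = ∑ k ∈ Finset.range K, (if sel k then 1 else 0) * zeroRun β m r ((blockMap β m)^[k] x) := by
  induction K with
  | zero => rfl
  | succ K ih =>
    have hy := h.iterate_blockMap_mem hx K
    rw [blockStart_succ, Finset.sum_range_add, ih, Finset.sum_range_succ _ K,
      ← h.sum_block_eq_zeroRun hy, Finset.mul_sum]
    congr 1
    refine Finset.sum_congr rfl fun i hi => ?_
    have h1 : ∀ j, (greedyMap β)^[blockStart β m x K + j] x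
        = (greedyMap β)^[j] ((blockMap β m)^[K] x) := fun j => by
      rw [add_comm, Function.iterate_add_apply, h.iterate_greedyMap_blockStart hx]
    have h2 : zeroCount β x (blockStart β m x K + i) = K := by
      rw [zeroCount_add, h.zeroCount_blockStart hx, h.iterate_greedyMap_blockStart hx,
        h.zeroCount_block hy (by have := Finset.mem_range.1 hi; omega), add_zero]
    unfold runMark
    rw [h2, add_assoc, h1, h1]
    by_cases hs : sel K <;> simp [hs]

theorem greedyDigit_eq_zero_of_lt (h : IsPseudoGolden β m) {x : ℝ} {n r : ℕ}
    (hn : (greedyMap β)^[n] x < β⁻¹ ^ r) : ∀ i < r, greedyDigit β x (n + i) = 0 := by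
  have key : ∀ i ≤ r, (greedyMap β)^[n + i] x < β⁻¹ ^ (r - i) := by
    intro i
    induction i with
    | zero => simpa using hn
    | succ i ih =>
      intro hi
      have h1 := ih (by omega)
      have h2 : β⁻¹ ^ (r - i) ≤ β⁻¹ := by
        simpa using pow_le_pow_of_le_one h.inv_pos.le h.inv_lt_one.le (show 1 ≤ r - i by omega)
      rw [← add_assoc, Function.iterate_succ_apply', greedyMap, if_pos (h1.trans_le h2)]
      rw [show r - i = r - (i + 1) + 1 by omega, pow_succ'] at h1
      have := mul_lt_mul_of_pos_left h1 h.pos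
      rwa [← mul_assoc, h.mul_inv, one_mul] at this
  intro i hi
  have h2 : β⁻¹ ^ (r - i) ≤ β⁻¹ := by
    simpa using pow_le_pow_of_le_one h.inv_pos.le h.inv_lt_one.le (show 1 ≤ r - i by omega)
  exact if_pos ((key i hi.le).trans_le h2)

/-- A mark of the second kind lies on a greedy 0, namely the last digit that the first carry turns
into 1; the run of 2m zeros leaves m zeros after it. -/
theorem isCarryMark_blockMark (h : IsPseudoGolden β m) (sel : ℕ → Prop) (x : ℝ) :
    IsCarryMark m (greedyDigit β x) (blockMark β m sel x) := by
  have hm := h.two_le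
  have hone : ∀ r n, runMark β r sel x n ≠ 0 → greedyDigit β x n = 1 := by
    intro r n hn
    unfold runMark at hn
    split_ifs at hn with hc
    · exact if_neg (not_lt.2 hc.1.1)
    · exact absurd rfl hn
  have hzero : ∀ r n, runMark β r sel x n ≠ 0 →
      ∀ i, 1 ≤ i → i ≤ r + 1 → greedyDigit β x (n + i) = 0 := by
    intro r n hn i hi hir
    unfold runMark at hn
    split_ifs at hn with hc
    · have := h.greedyDigit_eq_zero_of_lt hc.1.2 (i - 1) (by omega)
      rwa [show n + 1 + (i - 1) = n + i by omega] at this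
    · exact absurd rfl hn
  have hmono : ∀ n, runMark β (2 * m - 1) sel x n ≠ 0 → runMark β (m - 1) sel x n = 1 := by
    intro n hn
    unfold runMark at hn ⊢
    split_ifs at hn with hc
    · refine if_pos ⟨⟨hc.1.1, hc.1.2.trans_le ?_⟩, hc.2⟩
      exact pow_le_pow_of_le_one h.inv_pos.le h.inv_lt_one.le (by omega)
    · exact absurd rfl hn
  have hlag : ∀ n, lag (runMark β (2 * m - 1) sel x) m n ≠ 0 →
      m ≤ n ∧ runMark β (2 * m - 1) sel x (n - m) ≠ 0 := by
    intro n hn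
    unfold lag at hn
    split_ifs at hn with hc
    · exact ⟨hc, hn⟩
    · exact absurd rfl hn
  -- The two kinds of marks never coincide: the first kind lies on a greedy 1, the second on a
  -- greedy 0.
  have hle : ∀ n, blockMark β m sel x n ≤ 1 := by
    intro n
    have h1 := runMark_le_one β (m - 1) sel x n
    unfold blockMark
    by_cases h0 : lag (runMark β (2 * m - 1) sel x) m n = 0
    · omega
    · obtain ⟨h2, h3⟩ := hlag n h0
      have h4 : lag (runMark β (2 * m - 1) sel x) m n ≤ 1 := by
        rw [lag, if_pos h2]
        exact runMark_le_one _ _ _ _ _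
      have h5 := hzero _ _ h3 m (by omega) (by omega)
      rw [Nat.sub_add_cancel h2] at h5
      have h6 : runMark β (m - 1) sel x n = 0 := by
        by_contra h7
        have := hone _ _ h7
        omega
      omega
  have hcases : ∀ n, blockMark β m sel x n = 1 → runMark β (m - 1) sel x n ≠ 0 ∨
      (m ≤ n ∧ runMark β (2 * m - 1) sel x (n - m) ≠ 0) := by
    intro n hn
    by_cases h0 : lag (runMark β (2 * m - 1) sel x) m n = 0
    · left
      unfold blockMark at hn
      omega
    · exact Or.inr (hlag n h0)
  refine ⟨greedyDigit_le_one β x, hle, fun n i hn hi him => ?_, fun n hn => ?_⟩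
  · rcases hcases n hn with h1 | ⟨h1, h2⟩
    · exact hzero _ _ h1 i hi (by omega)
    · have := hzero _ _ h2 (m + i) (by omega) (by omega)
      rwa [show n - m + (m + i) = n + i by omega] at this
  · rcases hcases n hn with h1 | ⟨h1, h2⟩
    · exact Or.inl (hone _ _ h1)
    · refine Or.inr ⟨h1, ?_⟩
      have h3 := hle (n - m)
      have h4 := hmono _ h2
      unfold blockMark at h3 ⊢
      omega

end IsPseudoGolden

/-! ### Expansions obtained by carrying in selected blocks. -/

namespace IsPseudoGolden

variable {β : ℝ} {m : ℕ}

theorem betaAlphabet_eq (h : IsPseudoGolden β m) {k : ℕ} : k ∈ betaAlphabet β ↔ k ≤ 1 := by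
  have : ⌈β⌉₊ = 2 := by
    rw [Nat.ceil_eq_iff two_ne_zero]
    exact ⟨by simpa using h.one_lt, by simpa using h.lt_two.le⟩
  rw [betaAlphabet, Set.mem_ofPred_eq, this]
  omega

theorem betaInterval_eq (h : IsPseudoGolden β m) :
    betaInterval β = Set.Icc 0 (1 / (β - 1)) := by
  have : ⌈β⌉₊ = 2 := by
    rw [Nat.ceil_eq_iff two_ne_zero]
    exact ⟨by simpa using h.one_lt, by simpa using h.lt_two.le⟩
  rw [betaInterval, this]
  norm_num

open Classical in
theorem carry_blockMark_spec (h : IsPseudoGolden β m) {x : ℝ} (hx : x ∈ Set.Ico (0 : ℝ) 1)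
    {sel : ℕ → Prop} {l D₁ D₂ : ℝ} (hl : 0 < l)
    (hlen : Tendsto (fun n : ℕ => (∑ k ∈ Finset.range n,
      ((blockIndex β m ((blockMap β m)^[k] x) : ℝ) + 1)) / n) atTop (𝓝 l))
    (h₁ : Tendsto (fun n : ℕ => (∑ k ∈ Finset.range n,
      (if sel k then 1 else 0) * zeroRun β m (m - 1) ((blockMap β m)^[k] x)) / n) atTop (𝓝 D₁))
    (h₂ : Tendsto (fun n : ℕ => (∑ k ∈ Finset.range n,
      (if sel k then 1 else 0) * zeroRun β m (2 * m - 1) ((blockMap β m)^[k] x)) / n)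
        atTop (𝓝 D₂)) :
    IsBetaExpansion β x (carry m (greedyDigit β x) (blockMark β m sel x)) ∧
      HasDigitFreq (carry m (greedyDigit β x) (blockMark β m sel x)) 0
        ((1 - (m - 1) * (D₁ + D₂)) / l) := by
  have hm : 1 ≤ m := one_le_two.trans h.two_le
  have hmark := h.isCarryMark_blockMark sel x
  have hstart : Tendsto (fun K : ℕ => (blockStart β m x K : ℝ) / K) atTop (𝓝 l) := by
    refine hlen.congr fun K => ?_
    simp [blockStart]
  have hsub : ∀ {F : ℕ → ℝ}, (∀ n, 0 ≤ F n) → ∀ {e : ℝ},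
      Tendsto (fun K : ℕ => (∑ n ∈ Finset.range (blockStart β m x K), F n) / K) atTop (𝓝 e) →
      Tendsto (fun N : ℕ => (∑ n ∈ Finset.range N, F n) / N) atTop (𝓝 (e / l)) := by
    intro F hF e he
    refine tendsto_div_of_tendsto_div_strictMono (F := fun N => ∑ n ∈ Finset.range N, F n)
      (monotone_nat_of_le_succ fun n => ?_) (by simp) (strictMono_blockStart β m x) rfl hl hstart he
    rw [Finset.sum_range_succ]
    exact le_add_of_nonneg_right (hF n)
  have hr₁ := hsub (F := fun n => (runMark β (m - 1) sel x n : ℝ)) (fun n => Nat.cast_nonneg _)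
    (h₁.congr fun K => by rw [h.sum_runMark_blockStart hx])
  have hr₂ := hsub (F := fun n => (runMark β (2 * m - 1) sel x n : ℝ))
    (fun n => Nat.cast_nonneg _) (h₂.congr fun K => by rw [h.sum_runMark_blockStart hx])
  -- There is one zero per block, so the average of zeros per block is 1.
  have hz : HasDigitFreq (greedyDigit β x) 0 (1 / l) := by
    have hcount : ∀ N, ∑ n ∈ Finset.range N, (1 - (greedyDigit β x n : ℝ))
        = (zeroCount β x N : ℝ) := by
      intro N
      rw [zeroCount]
      push_cast [Nat.cast_sub (greedyDigit_le_one β x _)]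
      rfl
    have h1 := hsub (F := fun n => 1 - (greedyDigit β x n : ℝ))
      (fun n => sub_nonneg.2 (by exact_mod_cast greedyDigit_le_one β x n)) (e := 1) ?_
    · refine h1.congr fun N => ?_
      rw [card_zeros_eq (greedyDigit_le_one β x), Finset.sum_sub_distrib]
      simp
    · refine tendsto_const_nhds.congr' ?_
      filter_upwards [eventually_ge_atTop 1] with K hK
      have : (K : ℝ) ≠ 0 := by positivity
      rw [hcount, h.zeroCount_blockStart hx, div_self this]
  have hc : Tendsto (fun N : ℕ => (∑ n ∈ Finset.range N, (blockMark β m sel x n : ℝ)) / N) atTop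
      (𝓝 (D₁ / l + D₂ / l)) := by
    refine (hr₁.add (tendsto_shift_div hr₂ m)).congr fun N => ?_
    have h1 := sum_range_lag (runMark β (2 * m - 1) sel x) m N
    have h2 : ∑ n ∈ Finset.range N, (lag (runMark β (2 * m - 1) sel x) m n : ℝ)
        = ∑ n ∈ Finset.range (N - m), (runMark β (2 * m - 1) sel x n : ℝ) := by
      exact_mod_cast h1
    simp only [← h2, ← add_div, ← Finset.sum_add_distrib, blockMark, Nat.cast_add]
  refine ⟨⟨fun i => h.betaAlphabet_eq.2 (hmark.carry_spec hm i).2.1,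
    hmark.hasSum_carry h (h.hasSum_greedyDigit hx)⟩, ?_⟩
  have := hmark.hasDigitFreq_carry hm hz hc
  rwa [show 1 / l - (m - 1) * (D₁ / l + D₂ / l) = (1 - (m - 1) * (D₁ + D₂)) / l by ring] at this

/-- Place n is preceded by at most n zeros, so it lies in a block numbered at most n < j, and
carries only affect places from their mark on. -/
theorem _root_.carry_blockMark_eq_of_lt {x : ℝ} {sel : ℕ → Prop} {j : ℕ}
    (hsel : ∀ k < j, ¬ sel k) {n : ℕ} (hn : n < j) :
    carry m (greedyDigit β x) (blockMark β m sel x) n = greedyDigit β x n := by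
  have hrun : ∀ r, ∀ i < j, runMark β r sel x i = 0 := fun r i hi =>
    if_neg fun hc => hsel _ ((zeroCount_le β x i).trans_lt hi) hc.2
  have hlag : ∀ r k, ∀ i < j, lag (runMark β r sel x) k i = 0 := by
    intro r k i hi
    unfold lag
    split_ifs
    · exact hrun r _ (by omega)
    · rfl
  have hmark : ∀ i < j, blockMark β m sel x i = 0 := fun i hi => by
    rw [blockMark, hrun _ i hi, hlag _ _ i hi]
  rw [carry, hmark n hn, Finset.sum_eq_zero, add_zero, Nat.sub_zero]
  intro i _
  unfold lag
  split_ifs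
  · exact hmark _ (by omega)
  · rfl

theorem carry_blockMark_ne (h : IsPseudoGolden β m) {x : ℝ} (hx : x ∈ Set.Ico (0 : ℝ) 1)
    {sel : ℕ → Prop} {j : ℕ} (hsel : sel j)
    (hj : zeroRun β m (m - 1) ((blockMap β m)^[j] x) ≠ 0) :
    carry m (greedyDigit β x) (blockMark β m sel x) ≠ greedyDigit β x := by
  classical
  have hm : 1 ≤ m := one_le_two.trans h.two_le
  have hex : ∃ n, runMark β (m - 1) sel x n ≠ 0 := by
    -- Without marks, the mark counts up to block starts j and j + 1 would agree, although block j
    -- is selected and contributes a nonzero `zeroRun`.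
    by_contra! hcon
    have h1 := h.sum_runMark_blockStart hx (m - 1) sel
    simp only [hcon, Nat.cast_zero, Finset.sum_const_zero] at h1
    have h2 := h1 (j + 1)
    rw [Finset.sum_range_succ, ← h1 j, if_pos hsel, zero_add, one_mul] at h2
    exact hj h2.symm
  obtain ⟨n, hn⟩ := hex
  have hmark := h.isCarryMark_blockMark sel x
  have h1 : blockMark β m sel x n = 1 := by
    have h2 := hmark.mark_le n
    unfold blockMark at h2 ⊢
    omega
  have h2 : greedyDigit β x n = 1 := by
    unfold runMark at hn
    split_ifs at hn with hc
    · exact if_neg (not_lt.2 hc.1.1)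
    · exact absurd rfl hn
  intro heq
  have h3 := (hmark.carry_spec hm n).2.2 h1
  rw [heq, h2] at h3
  exact one_ne_zero h3

open Classical in
theorem infinite_expansions (h : IsPseudoGolden β m) {x : ℝ} (hx : x ∈ Set.Ico (0 : ℝ) 1)
    {sel : ℕ → Prop} {l D₁ D₂ : ℝ} (hl : 0 < l)
    (hlen : Tendsto (fun n : ℕ => (∑ k ∈ Finset.range n,
      ((blockIndex β m ((blockMap β m)^[k] x) : ℝ) + 1)) / n) atTop (𝓝 l))
    (h₁ : Tendsto (fun n : ℕ => (∑ k ∈ Finset.range n,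
      (if sel k then 1 else 0) * zeroRun β m (m - 1) ((blockMap β m)^[k] x)) / n) atTop (𝓝 D₁))
    (h₂ : Tendsto (fun n : ℕ => (∑ k ∈ Finset.range n,
      (if sel k then 1 else 0) * zeroRun β m (2 * m - 1) ((blockMap β m)^[k] x)) / n)
        atTop (𝓝 D₂))
    (hinf : {j | zeroRun β m (m - 1) ((blockMap β m)^[j] x) ≠ 0}.Infinite) :
    {ε : ℕ → ℕ | IsBetaExpansion β x ε ∧
      HasDigitFreq ε 0 ((1 - (m - 1) * (D₁ + D₂)) / l)}.Infinite := by
  -- Drop all blocks before j, force block j, keep `sel` afterwards. Then `ε j` agrees with the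
  -- greedy digits before place j, has the same limiting frequency, and differs from the greedy
  -- expansion if block j admits a carry.
  obtain ⟨sel', hsel'⟩ : ∃ s : ℕ → ℕ → Prop, s = fun j k => k = j ∨ (j < k ∧ sel k) := ⟨_, rfl⟩
  set ε : ℕ → ℕ → ℕ := fun j => carry m (greedyDigit β x) (blockMark β m (sel' j) x) with hε
  have hmem : ∀ j, IsBetaExpansion β x (ε j) ∧
      HasDigitFreq (ε j) 0 ((1 - (m - 1) * (D₁ + D₂)) / l) := by
    intro j
    have hiff : ∀ k, j < k → (sel k ↔ sel' j k) := fun k hk => by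
      simp only [hsel', hk.ne', hk, true_and, false_or]
    have hite : ∀ k, j < k →
        (if sel k then (1 : ℝ) else 0) = if sel' j k then (1 : ℝ) else 0 := fun k hk => by
      by_cases hs : sel k
      · rw [if_pos hs, if_pos ((hiff k hk).1 hs)]
      · rw [if_neg hs, if_neg (mt (hiff k hk).2 hs)]
    refine h.carry_blockMark_spec hx hl hlen ?_ ?_
    · exact tendsto_average_of_eq_of_lt (j := j) (fun k hk => by rw [hite k hk]) h₁
    · exact tendsto_average_of_eq_of_lt (j := j) (fun k hk => by rw [hite k hk]) h₂
  refine Set.Infinite.mono (s := ε '' {j | zeroRun β m (m - 1) ((blockMap β m)^[j] x) ≠ 0})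
    (by rintro _ ⟨j, -, rfl⟩; exact hmem j) fun hfin => ?_
  -- If only finitely many sequences occurred, one of them would be `ε j` for arbitrarily large j,
  -- hence equal to the greedy expansion.
  obtain ⟨δ, hδ⟩ : ∃ δ, {j ∈ {j | zeroRun β m (m - 1) ((blockMap β m)^[j] x) ≠ 0} |
      ε j = δ}.Infinite := by
    by_contra! hcon
    refine hinf ((hfin.biUnion fun δ _ => hcon δ).subset fun j hj => ?_)
    exact Set.mem_biUnion (Set.mem_image_of_mem ε hj) ⟨hj, rfl⟩
  have hδg : δ = greedyDigit β x := by
    funext n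
    obtain ⟨j, ⟨-, hj⟩, hnj⟩ := hδ.exists_gt n
    rw [← hj]
    refine carry_blockMark_eq_of_lt (j := j) (fun k hk => ?_) hnj
    simp only [hsel']
    omega
  obtain ⟨j, hj, hj'⟩ := hδ.nonempty
  exact h.carry_blockMark_ne hx (sel := sel' j) (by simp [hsel']) hj (hj'.trans hδg)

/-! ### Numerical relations, in terms of `s = β⁻¹ ^ (m + 1)` -/

theorem two_mul_inv (h : IsPseudoGolden β m) : 2 * β⁻¹ = 1 + β⁻¹ ^ (m + 1) := by
  have h1 := mul_neg_geom_sum β⁻¹ m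
  have h2 := h.sum_inv_pow
  simp_rw [pow_succ', ← Finset.mul_sum] at h2
  rw [pow_succ']
  linear_combination (1 - β⁻¹) * h2 - β⁻¹ * h1

/-- Since m ≥ 2, s ≤ q³, so 2q = 1 + s gives (q - 1)(q² + q - 1) ≥ 0. If s > 1/4 then q > 5/8, which
makes q² + q - 1 positive, a contradiction. -/
theorem pow_le_quarter (h : IsPseudoGolden β m) : β⁻¹ ^ (m + 1) ≤ 1 / 4 := by
  have h1 := h.two_mul_inv
  have h2 := h.inv_pos
  have h3 := h.inv_lt_one
  have h4 : β⁻¹ ^ (m + 1) ≤ β⁻¹ ^ 3 :=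
    pow_le_pow_of_le_one h2.le h3.le (by have := h.two_le; omega)
  by_contra! h5
  have h6 : 5 / 8 < β⁻¹ := by linarith
  have h7 : 0 ≤ (β⁻¹ - 1) * (β⁻¹ ^ 2 + β⁻¹ - 1) := by nlinarith
  have h8 : 0 < β⁻¹ ^ 2 + β⁻¹ - 1 := by nlinarith
  nlinarith [mul_pos (sub_pos.2 h3) h8]

/-- The m terms q, ..., q^m sum to 1 and q^m is the least of them. This gives the positivity of l
and of c. -/
theorem mul_pow_lt_one (h : IsPseudoGolden β m) : m * β⁻¹ ^ (m + 1) < 1 := by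
  have h1 := h.sum_inv_pow
  have h2 : (m : ℝ) * β⁻¹ ^ m ≤ 1 := by
    rw [← h1]
    have := Finset.card_nsmul_le_sum (Finset.range m) (fun j => β⁻¹ ^ (j + 1)) (β⁻¹ ^ m)
      fun j hj => pow_le_pow_of_le_one h.inv_pos.le h.inv_lt_one.le (Finset.mem_range.1 hj)
    simpa [-inv_pow] using this
  have h3 : (0 : ℝ) < m * β⁻¹ ^ m := by
    have := h.two_le
    have := h.inv_pos
    positivity
  rw [pow_succ, ← mul_assoc]
  nlinarith [h.inv_lt_one]

theorem sum_length (h : IsPseudoGolden β m) :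
    ∑ j ∈ Finset.range m, β⁻¹ ^ (j + 1) * ((j : ℝ) + 1)
      = 2 * (1 - m * β⁻¹ ^ (m + 1)) / (1 - β⁻¹ ^ (m + 1)) := by
  have hs := h.pow_le_quarter
  have h1 : ∀ n : ℕ, (1 - β⁻¹) * ∑ j ∈ Finset.range n, β⁻¹ ^ (j + 1) * ((j : ℝ) + 1)
      = ∑ j ∈ Finset.range n, β⁻¹ ^ (j + 1) - n * β⁻¹ ^ (n + 1) := by
    intro n
    induction n with
    | zero => simp
    | succ n ih =>
      rw [Finset.sum_range_succ, Finset.sum_range_succ, mul_add, ih]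
      push_cast
      ring
  have h2 := h1 m
  rw [h.sum_inv_pow] at h2
  rw [eq_div_iff (by linarith)]
  linear_combination 2 * h2 + (∑ j ∈ Finset.range m, β⁻¹ ^ (j + 1) * ((j : ℝ) + 1)) * h.two_mul_inv

theorem range_eq (h : IsPseudoGolden β m) :
    (((m : ℝ) - 1) * (2 - β)) / (2 * ((m : ℝ) * β + β - 2 * (m : ℝ)))
      = (m - 1) * β⁻¹ ^ (m + 1) / (2 * (1 - m * β⁻¹ ^ (m + 1))) := by
  have h1 := h.two_mul_inv
  have h2 := h.mul_pow_lt_one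
  set s := β⁻¹ ^ (m + 1)
  have h3 : 2 - β = β * s := by linear_combination β * h1 - 2 * h.mul_inv
  have h4 : (m : ℝ) * β + β - 2 * m = β * (1 - m * s) := by linear_combination -m * h3
  have h5 := h.pos.ne'
  have h6 : 1 - m * s ≠ 0 := by linarith
  rw [h3, h4]
  field_simp

theorem range_pos (h : IsPseudoGolden β m) :
    0 < (m - 1) * β⁻¹ ^ (m + 1) / (2 * (1 - m * β⁻¹ ^ (m + 1))) := by
  have h1 : (2 : ℝ) ≤ m := by exact_mod_cast h.two_le
  exact div_pos (mul_pos (by linarith) (pow_pos h.inv_pos _)) (by linarith [h.mul_pow_lt_one])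

/-- Multiplied by (m - 1)/l, the left side is c, the excess of the greedy frequency over 1/2, and
the right side is the largest reduction that the carries achieve. For m = 2 the first term alone is
too small, hence the second carry. -/
theorem reduction_bound (h : IsPseudoGolden β m) :
    β⁻¹ ^ (m + 1) / (1 - β⁻¹ ^ (m + 1))
      ≤ (1 - β⁻¹) * β⁻¹ ^ (m - 1) + (1 - β⁻¹) * β⁻¹ ^ (2 * m - 1) := by
  have h1 := h.two_mul_inv
  have h2 := h.pow_le_quarter
  have hq := h.inv_pos
  have h3 : β⁻¹ ^ (m + 1) = β⁻¹ ^ (m - 1) * β⁻¹ ^ 2 := by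
    rw [← pow_add]; congr 1; have := h.two_le; omega
  have h4 : (β⁻¹ ^ (m + 1)) ^ 2 = β⁻¹ ^ (2 * m - 1) * β⁻¹ ^ 3 := by
    rw [← pow_add, ← pow_mul]; congr 1; have := h.two_le; omega
  set s := β⁻¹ ^ (m + 1) with hs
  have hs0 : 0 < s := pow_pos hq _
  set q := β⁻¹
  have e1 : q ^ (m - 1) = s / q ^ 2 := by rw [h3]; field_simp
  have e2 : q ^ (2 * m - 1) = s ^ 2 / q ^ 3 := by rw [h4]; field_simp
  rw [e1, e2, div_le_iff₀ (by linarith)]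
  have e3 : ((1 - q) * (s / q ^ 2) + (1 - q) * (s ^ 2 / q ^ 3)) * (1 - s)
      = s * ((1 - q) * (q + s) * (1 - s) / q ^ 3) := by field_simp
  rw [e3]
  refine le_mul_of_one_le_right hs0.le ?_
  rw [one_le_div (by positivity)]
  have hq' : q = (1 + s) / 2 := by linarith
  -- The claim is now 2(1 - s)²(1 + 3s) ≥ (1 + s)³ for 0 < s ≤ 1/4, which is nearly sharp at s =
  -- 1/4.
  rw [hq']
  nlinarith [mul_pos hs0 hs0, mul_nonneg hs0.le (sub_nonneg.2 h2),
    mul_nonneg (mul_pos hs0 hs0).le (sub_nonneg.2 h2)]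

end IsPseudoGolden

/-! ### Choice of the density and the result on [0, 1). -/

open Classical in
-- Select k when ⌊kt⌋ jumps; as t ≤ 1 the jumps are at most 1, and the count telescopes to ⌊nt⌋.
theorem exists_density {t : ℝ} (ht : t ∈ Set.Icc (0 : ℝ) 1) :
    ∃ sel : ℕ → Prop, Tendsto (fun n : ℕ => (∑ k ∈ Finset.range n,
      if sel k then (1 : ℝ) else 0) / (n : ℝ)) atTop (𝓝 t) := by
  obtain ⟨sel, hsel⟩ : ∃ s : ℕ → Prop, s = fun k : ℕ => ⌊(k : ℝ) * t⌋₊ < ⌊((k + 1 : ℕ) : ℝ) * t⌋₊ :=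
    ⟨_, rfl⟩
  refine ⟨sel, ?_⟩
  have hsum : ∀ n : ℕ,
      (∑ k ∈ Finset.range n, if sel k then (1 : ℝ) else 0) = ⌊(n : ℝ) * t⌋₊ := by
    intro n
    induction n with
    | zero => simp
    | succ n ih =>
      rw [Finset.sum_range_succ, ih]
      have h1 : ⌊(n : ℝ) * t⌋₊ ≤ ⌊((n + 1 : ℕ) : ℝ) * t⌋₊ := Nat.floor_mono (by
        push_cast; nlinarith [ht.1])
      have h2 : ⌊((n + 1 : ℕ) : ℝ) * t⌋₊ ≤ ⌊(n : ℝ) * t⌋₊ + 1 := by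
        rw [← Nat.floor_add_one (mul_nonneg (Nat.cast_nonneg n) ht.1)]
        exact Nat.floor_mono (by push_cast; nlinarith [ht.2])
      split_ifs with h3 <;> simp only [hsel] at h3
      · rw [show ⌊((n + 1 : ℕ) : ℝ) * t⌋₊ = ⌊(n : ℝ) * t⌋₊ + 1 by omega]
        push_cast
        rfl
      · rw [show ⌊((n + 1 : ℕ) : ℝ) * t⌋₊ = ⌊(n : ℝ) * t⌋₊ by omega, add_zero]
  simp_rw [hsum]
  have := (tendsto_nat_floor_mul_div_atTop (R := ℝ) ht.1).comp tendsto_natCast_atTop_atTop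
  refine this.congr fun n => ?_
  simp only [Function.comp, mul_comm]

namespace IsPseudoGolden

variable {β : ℝ} {m : ℕ}

theorem ae_unitMeasure_infinite (h : IsPseudoGolden β m) {p : ℝ}
    (hp : p ∈ Set.Icc (1 / 2)
      (1 / 2 + (m - 1) * β⁻¹ ^ (m + 1) / (2 * (1 - m * β⁻¹ ^ (m + 1))))) :
    ∀ᵐ x ∂unitMeasure,
      {ε : ℕ → ℕ | IsBetaExpansion β x ε ∧ HasDigitFreq ε 0 p}.Infinite := by
  classical
  have hm : (2 : ℝ) ≤ m := by exact_mod_cast h.two_le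
  have hms := h.mul_pow_lt_one
  have hs4 := h.pow_le_quarter
  have hs0 : 0 < β⁻¹ ^ (m + 1) := pow_pos h.inv_pos _
  have hbd := h.reduction_bound
  have hq0 := h.inv_pos
  have hq1 := h.inv_lt_one
  set s := β⁻¹ ^ (m + 1) with hs
  set d₁ := (1 - β⁻¹) * β⁻¹ ^ (m - 1) with hd₁
  set d₂ := (1 - β⁻¹) * β⁻¹ ^ (2 * m - 1) with hd₂
  set l := 2 * (1 - m * s) / (1 - s) with hl
  have hl0 : 0 < l := div_pos (by linarith) (by linarith)
  have hd₁0 : 0 < d₁ := mul_pos (by linarith) (pow_pos hq0 _)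
  have hd0 : 0 < d₁ + d₂ := add_pos hd₁0 (mul_pos (by linarith) (pow_pos hq0 _))
  have hc : (m - 1) * s / (2 * (1 - m * s)) * l = (m - 1) * (s / (1 - s)) := by
    have : 1 - m * s ≠ 0 := by linarith
    have : 1 - s ≠ 0 := by linarith
    rw [hl]
    field_simp
  have hinvl : (1 / 2 + (m - 1) * s / (2 * (1 - m * s))) * l = 1 := by
    have : 1 - s ≠ 0 := by linarith
    rw [add_mul, hc, hl]
    field_simp
    ring
  -- The solution of (1 - (m-1) t (d₁ + d₂)) / l = p. Since (1/2 + c) l = 1, the upper bound on p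
  -- gives t ≥ 0; the lower bound p ≥ 1/2 and `reduction_bound` give t ≤ 1.
  set t := (1 - p * l) / ((m - 1) * (d₁ + d₂)) with htdef
  have hden : 0 < (m - 1) * (d₁ + d₂) := mul_pos (by linarith) hd0
  have ht : t ∈ Set.Icc (0 : ℝ) 1 := by
    constructor
    · refine div_nonneg ?_ hden.le
      have := mul_le_mul_of_nonneg_right hp.2 hl0.le
      linarith
    · rw [htdef, div_le_one hden]
      have h1 := mul_le_mul_of_nonneg_right hp.1 hl0.le
      have h2 : (m - 1) * (s / (1 - s)) ≤ (m - 1) * (d₁ + d₂) :=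
        mul_le_mul_of_nonneg_left hbd (by linarith)
      rw [add_mul, hc] at hinvl
      linarith
  have hpt : (1 - (m - 1) * (t * d₁ + t * d₂)) / l = p := by
    have h1 : t * ((m - 1) * (d₁ + d₂)) = 1 - p * l := div_mul_cancel₀ _ hden.ne'
    rw [div_eq_iff hl0.ne']
    linear_combination -h1
  obtain ⟨sel, hsel⟩ := exists_density ht
  have hone : Tendsto (fun n : ℕ => (∑ _k ∈ Finset.range n, (1 : ℝ)) / (n : ℝ)) atTop (𝓝 1) := by
    refine tendsto_const_nhds.congr' ?_
    filter_upwards [eventually_ge_atTop 1] with n hn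
    have : (n : ℝ) ≠ 0 := by positivity
    simp [this]
  have hw : ∀ k, |if sel k then (1 : ℝ) else 0| ≤ 1 := fun k => by split_ifs <;> simp
  have A₀ := h.ae_tendsto_weighted_average h.isBlockLocal_length (a := fun _ => 1) (by simp) hone
  have A₁ := h.ae_tendsto_weighted_average (h.isBlockLocal_zeroRun (m - 1)) hw hsel
  have A₂ := h.ae_tendsto_weighted_average (h.isBlockLocal_zeroRun (2 * m - 1)) hw hsel
  have A₃ := h.ae_tendsto_weighted_average (h.isBlockLocal_zeroRun (m - 1)) (a := fun _ => 1)
    (by simp) hone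
  rw [h.integral_length, h.sum_length] at A₀
  rw [h.integral_zeroRun] at A₁ A₂ A₃
  filter_upwards [A₀, A₁, A₂, A₃, ae_restrict_mem measurableSet_Ico] with x h₀ h₁ h₂ h₃ hx
  simp only [one_mul] at h₀ h₃
  rw [← hpt]
  refine h.infinite_expansions hx hl0 h₀ h₁ h₂ fun hfin => ?_
  obtain ⟨j, hj⟩ := hfin.bddAbove
  have h4 := tendsto_average_of_eq_of_lt (j := j) (v := fun _ => 0) (fun k hk => by
    by_contra hk0
    exact absurd (hj hk0) (not_le.2 hk)) h₃
  simp only [Finset.sum_const_zero, zero_div] at h4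
  exact hd₁0.ne (tendsto_nhds_unique tendsto_const_nhds h4)

/-! ### Transfer to the whole interval and to frequencies below 1/2. -/

theorem infinite_of_mul_sub_one (h : IsPseudoGolden β m) {p x : ℝ}
    (hx : {ε : ℕ → ℕ | IsBetaExpansion β (β * x - 1) ε ∧ HasDigitFreq ε 0 p}.Infinite) :
    {ε : ℕ → ℕ | IsBetaExpansion β x ε ∧ HasDigitFreq ε 0 p}.Infinite := by
  set cons : (ℕ → ℕ) → ℕ → ℕ := fun ε n => Nat.casesOn n 1 ε with hcons
  have hinj : Function.Injective cons := fun ε δ hεδ => funext fun n => congrFun hεδ (n + 1)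
  refine (hx.image hinj.injOn).mono ?_
  rintro _ ⟨ε, ⟨⟨h1, h2⟩, h3⟩, rfl⟩
  have hcons0 : cons ε 0 = 1 := rfl
  have hconsS : ∀ n, cons ε (n + 1) = ε n := fun _ => rfl
  have h1' : ∀ i, cons ε i ≤ 1 := by
    rintro (_ | i)
    · exact le_rfl
    · exact h.betaAlphabet_eq.1 (h1 i)
  refine ⟨⟨fun i => h.betaAlphabet_eq.2 (h1' i), ?_⟩, ?_⟩
  · have hβ := h.pos
    have h4 := (hasSum_nat_add_iff (f := fun n : ℕ => (cons ε n : ℝ) / β ^ (n + 1)) 1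
      (g := β⁻¹ * (β * x - 1))).1 ((h2.mul_left β⁻¹).congr_fun fun n => by
        rw [hconsS, pow_succ β (n + 1)]
        field_simp)
    have h5 : β⁻¹ * (β * x - 1) + ∑ n ∈ Finset.range 1, (cons ε n : ℝ) / β ^ (n + 1) = x := by
      rw [Finset.sum_range_one, hcons0]
      simp only [Nat.cast_one, zero_add, pow_one]
      field_simp
      ring
    rwa [h5] at h4
  · unfold HasDigitFreq at h3 ⊢
    refine (tendsto_shift_div (F := fun N => (((Finset.range N).filter fun i => ε i = 0).card : ℝ))
      h3 1).congr' ?_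
    filter_upwards [eventually_ge_atTop 1] with N hN
    obtain ⟨N, rfl⟩ := Nat.exists_eq_add_of_le' hN
    rw [Nat.add_sub_cancel, card_zeros_eq h1', card_zeros_eq fun n => h.betaAlphabet_eq.1 (h1 n),
      Finset.sum_range_succ']
    simp only [hcons0, hconsS]
    push_cast
    congr 1
    ring

theorem infinite_of_reflect (h : IsPseudoGolden β m) {p x : ℝ}
    (hx : {ε : ℕ → ℕ | IsBetaExpansion β (1 / (β - 1) - x) ε ∧ HasDigitFreq ε 0 p}.Infinite) :
    {ε : ℕ → ℕ | IsBetaExpansion β x ε ∧ HasDigitFreq ε 0 (1 - p)}.Infinite := by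
  set flip : (ℕ → ℕ) → ℕ → ℕ := fun ε n => 1 - ε n with hflip
  refine (hx.image (f := flip) ?_).mono ?_
  · intro ε hε δ hδ heq
    funext n
    have h1 := h.betaAlphabet_eq.1 (hε.1.1 n)
    have h2 := h.betaAlphabet_eq.1 (hδ.1.1 n)
    have h3 : 1 - ε n = 1 - δ n := congrFun heq n
    omega
  rintro _ ⟨ε, ⟨⟨h1, h2⟩, h3⟩, rfl⟩
  have h1' : ∀ n, ε n ≤ 1 := fun n => h.betaAlphabet_eq.1 (h1 n)
  have hf1 : ∀ n, flip ε n ≤ 1 := fun n => Nat.sub_le _ _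
  have hcast : ∀ n, (flip ε n : ℝ) = 1 - ε n := fun n => by
    simp only [hflip]
    rw [Nat.cast_sub (h1' n), Nat.cast_one]
  refine ⟨⟨fun i => h.betaAlphabet_eq.2 (hf1 i), ?_⟩, ?_⟩
  · have hgeo : HasSum (fun n : ℕ => 1 / β ^ (n + 1)) (1 / (β - 1)) := by
      have h4 := (hasSum_geometric_of_lt_one h.inv_pos.le h.inv_lt_one).mul_left β⁻¹
      have h5 : β⁻¹ * (1 - β⁻¹)⁻¹ = 1 / (β - 1) := by
        have := h.pos.ne'
        have : β - 1 ≠ 0 := by linarith [h.one_lt]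
        rw [← _root_.mul_inv, mul_sub, h.mul_inv, mul_one, one_div]
      rw [h5] at h4
      refine h4.congr_fun fun n => ?_
      rw [pow_succ', one_div, _root_.mul_inv, inv_pow]
    have := hgeo.sub h2
    rw [sub_sub_cancel] at this
    refine this.congr_fun fun n => ?_
    rw [hcast, sub_div]
  · unfold HasDigitFreq at h3 ⊢
    refine (h3.const_sub 1).congr' ?_
    filter_upwards [eventually_ge_atTop 1] with N hN
    have hN0 : (N : ℝ) ≠ 0 := by positivity
    rw [card_zeros_eq hf1, card_zeros_eq h1']
    simp only [hcast, Finset.sum_sub_distrib, Finset.sum_const, Finset.card_range, nsmul_eq_mul,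
      mul_one]
    field_simp

theorem quasiMeasurePreserving_mul_sub_one (h : IsPseudoGolden β m) :
    Measure.QuasiMeasurePreserving (fun x : ℝ => β * x - 1) volume volume := by
  have h1 : Measure.QuasiMeasurePreserving (fun x : ℝ => β * x) volume volume := by
    refine ⟨measurable_const_mul β, ?_⟩
    rw [Real.map_volume_mul_left h.pos.ne']
    exact Measure.smul_absolutelyContinuous
  exact (measurePreserving_sub_right volume (1 : ℝ)).quasiMeasurePreserving.comp h1

/-- The map x ↦ βx - 1, which undoes a prefixed digit 1, expands away from its fixed point e = 1/(β
- 1). Hence the intervals [0, e - (e - 1) q^n), starting with [0, 1), exhaust [0, e), and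
exceptional null sets pull back to null sets. The point e itself is null. -/
theorem ae_infinite_of_half_le (h : IsPseudoGolden β m) {p : ℝ}
    (hp : p ∈ Set.Icc (1 / 2)
      (1 / 2 + (m - 1) * β⁻¹ ^ (m + 1) / (2 * (1 - m * β⁻¹ ^ (m + 1))))) :
    ∀ᵐ x, x ∈ Set.Icc 0 (1 / (β - 1)) →
      {ε : ℕ → ℕ | IsBetaExpansion β x ε ∧ HasDigitFreq ε 0 p}.Infinite := by
  set e := 1 / (β - 1) with he
  have hβ1 : 0 < β - 1 := by linarith [h.one_lt]
  have hbe : (β - 1) * e = 1 := by rw [he]; field_simp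
  have hbase := (ae_restrict_iff' measurableSet_Ico).1 (h.ae_unitMeasure_infinite hp)
  have hstep : ∀ n : ℕ, ∀ᵐ x, x ∈ Set.Ico 0 (e - (e - 1) * β⁻¹ ^ n) →
      {ε : ℕ → ℕ | IsBetaExpansion β x ε ∧ HasDigitFreq ε 0 p}.Infinite := by
    intro n
    induction n with
    | zero => simpa using hbase
    | succ n ih =>
      filter_upwards [hbase, h.quasiMeasurePreserving_mul_sub_one.ae ih] with x hx1 hx2 hx
      by_cases hlt : x < 1
      · exact hx1 ⟨hx.1, hlt⟩
      · refine h.infinite_of_mul_sub_one (hx2 ⟨?_, ?_⟩)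
        · nlinarith [h.one_lt]
        · have h1 := mul_lt_mul_of_pos_left hx.2 h.pos
          have h2 : β * (e - (e - 1) * β⁻¹ ^ (n + 1)) = e + 1 - (e - 1) * β⁻¹ ^ n := by
            rw [pow_succ]
            linear_combination hbe - (e - 1) * β⁻¹ ^ n * h.mul_inv
          linarith
  have hne : ∀ᵐ x : ℝ, x ≠ e := compl_mem_ae_iff.2 (measure_singleton e)
  filter_upwards [ae_all_iff.2 hstep, hne] with x hx hxe hmem
  have hlt : x < e := lt_of_le_of_ne hmem.2 hxe
  have hlim : Tendsto (fun n : ℕ => e - (e - 1) * β⁻¹ ^ n) atTop (𝓝 e) := by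
    simpa using ((tendsto_pow_atTop_nhds_zero_of_lt_one h.inv_pos.le h.inv_lt_one).const_mul
      (e - 1)).const_sub e
  obtain ⟨n, hn⟩ := (hlim.eventually (lt_mem_nhds hlt)).exists
  exact hx n ⟨hmem.1, hn⟩

end IsPseudoGolden

theorem theorem3 (β : ℝ) (hβ : β ∈ Set.Ioo (1 : ℝ) 2) (m : ℕ) (hm : 2 ≤ m)
    (hroot : β ^ m = ∑ i ∈ Finset.range m, β ^ i)
    (c : ℝ) (hc : c = (((m : ℝ) - 1) * (2 - β)) / (2 * ((m : ℝ) * β + β - 2 * (m : ℝ)))) :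
    0 < c ∧
      ∀ p ∈ Set.Icc (1 / 2 - c) (1 / 2 + c),
        ∀ᵐ x ∂(volume : Measure ℝ), x ∈ betaInterval β →
          {ε : ℕ → ℕ | IsBetaExpansion β x ε ∧ HasDigitFreq ε 0 p}.Infinite := by
  have h : IsPseudoGolden β m := ⟨hβ.1, hβ.2, hm, hroot⟩
  rw [h.range_eq] at hc
  refine ⟨hc ▸ h.range_pos, fun p hp => ?_⟩
  rw [h.betaInterval_eq]
  rcases le_total (1 / 2) p with hhalf | hhalf
  · exact h.ae_infinite_of_half_le ⟨hhalf, hc ▸ hp.2⟩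
  · have h1 := h.ae_infinite_of_half_le (p := 1 - p) ⟨by linarith, by rw [← hc]; linarith [hp.1]⟩
    filter_upwards [(Measure.measurePreserving_sub_left volume (1 / (β - 1))).quasiMeasurePreserving.ae h1]
      with x hx hmem
    have h2 := h.infinite_of_reflect (hx ⟨by linarith [hmem.2], by linarith [hmem.1]⟩)
    rwa [sub_sub_cancel] at h2
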